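/- Let $x_1\le x_2\le\dots\le x_n$ ($n\ge 1$) be the left endpoints of $n$ closed unit segments $I_i=[x_i,x_i+1]$ on the real line, given in this order, where each $I_i$ has one of $k$ colors, given as an integer in $\{0,\dots,k-1\}$, and each of the $k$ colors is used. A realization is a choice of one point (representative) $r_i\in I_i$ for each $i$. A color-spanning interval of a realization is a closed interval $[a,b]$, $a\le b$, that contains at least one representative of each color; a minimum color-spanning interval (MCSI) is one of minimum length. The L-MCSI problem asks for a realization for which the length of an MCSI is as large as possible. **Theorem.** If the input segments are pairwise disjoint, the L-MCSI problem can be solved in $O(n)$ time, for any number $k$ of colors. That is, there are one program on the unit-cost real RAM (exact real arithmetic $+,-,\cdot,/$ and comparisons, integers with successor, predecessor and comparisons, arrays with indirect addressing) and one constant $C$, such that for all $n$, $k$ and every such instance with pairwise disjoint segments the program halts after at most $C\,n$ steps and outputs a realization solving the L-MCSI problem. -/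

import Mathlib

/-! ### A unit-cost real RAM

The memory has integer registers, real registers, integer arrays and real arrays; registers and
arrays are numbered, and array cells are addressed through an integer register (indirect
addressing).  Programs are finite structured programs over elementary instructions.  Each
instruction and each elementary comparison costs one time unit.  On real numbers the machine has
exact `+`, `-`, `*`, `/` and comparisons, but no rounding.  On integers it has only successor and
predecessor, so that an integer grows by at most one per instruction apart from constants: no
exponentially large integers can be produced in linear time. -/

namespace RealRAM

/-- The contents of the memory. -/
structure State where
  /-- integer registers -/
  nat : ℕ → ℕ
  /-- real registers -/
  real : ℕ → ℝ
  /-- integer arrays: `natArr a i` is cell `i` of array `a` -/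
  natArr : ℕ → ℕ → ℕ
  /-- real arrays: `realArr a i` is cell `i` of array `a` -/
  realArr : ℕ → ℕ → ℝ

namespace State

def setNat (s : State) (v m : ℕ) : State :=
  { s with nat := Function.update s.nat v m }

noncomputable def setReal (s : State) (v : ℕ) (y : ℝ) : State :=
  { s with real := Function.update s.real v y }

def setNatArr (s : State) (a i m : ℕ) : State :=
  { s with natArr := Function.update s.natArr a (Function.update (s.natArr a) i m) }

noncomputable def setRealArr (s : State) (a i : ℕ) (y : ℝ) : State :=
  { s with realArr := Function.update s.realArr a (Function.update (s.realArr a) i y) }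

end State

/-- Elementary instructions.  The arguments `u`, `v`, `w` number registers, `a` numbers an array,
and `i` numbers the integer register that holds the index of the array cell. -/
inductive Instr where
  /-- integer register `v` := the constant `m` -/
  | natConst (v m : ℕ)
  /-- integer register `v` := integer register `w` -/
  | natCopy (v w : ℕ)
  /-- increase integer register `v` by one -/
  | natSucc (v : ℕ)
  /-- decrease integer register `v` by one (zero stays zero) -/
  | natPred (v : ℕ)
  /-- integer register `v` := the cell of integer array `a` addressed by `i` -/
  | natLoad (v a i : ℕ)
  /-- the cell of integer array `a` addressed by `i` := integer register `v` -/
  | natStore (a i v : ℕ)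
  /-- real register `v` := the rational constant `q` -/
  | realConst (v : ℕ) (q : ℚ)
  /-- real register `v` := real register `w` -/
  | realCopy (v w : ℕ)
  /-- real register `v` := integer register `w` -/
  | realCast (v w : ℕ)
  /-- real register `u` := `v + w` -/
  | realAdd (u v w : ℕ)
  /-- real register `u` := `v - w` -/
  | realSub (u v w : ℕ)
  /-- real register `u` := `v * w` -/
  | realMul (u v w : ℕ)
  /-- real register `u` := `v / w` (undefined if `w` holds zero) -/
  | realDiv (u v w : ℕ)
  /-- real register `v` := the cell of real array `a` addressed by `i` -/
  | realLoad (v a i : ℕ)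
  /-- the cell of real array `a` addressed by `i` := real register `v` -/
  | realStore (a i v : ℕ)

/-- The effect of an instruction; `none` means that the machine crashes. -/
noncomputable def Instr.step (s : State) : Instr → Option State
  | .natConst v m => some (s.setNat v m)
  | .natCopy v w => some (s.setNat v (s.nat w))
  | .natSucc v => some (s.setNat v (s.nat v + 1))
  | .natPred v => some (s.setNat v (s.nat v - 1))
  | .natLoad v a i => some (s.setNat v (s.natArr a (s.nat i)))
  | .natStore a i v => some (s.setNatArr a (s.nat i) (s.nat v))
  | .realConst v q => some (s.setReal v (q : ℝ))
  | .realCopy v w => some (s.setReal v (s.real w))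
  | .realCast v w => some (s.setReal v (s.nat w : ℝ))
  | .realAdd u v w => some (s.setReal u (s.real v + s.real w))
  | .realSub u v w => some (s.setReal u (s.real v - s.real w))
  | .realMul u v w => some (s.setReal u (s.real v * s.real w))
  | .realDiv u v w =>
      if s.real w = 0 then none else some (s.setReal u (s.real v / s.real w))
  | .realLoad v a i => some (s.setReal v (s.realArr a (s.nat i)))
  | .realStore a i v => some (s.setRealArr a (s.nat i) (s.real v))

/-- Branching conditions: comparisons of two registers, and Boolean combinations of these. -/
inductive Test where
  | natEq (v w : ℕ)
  | natLt (v w : ℕ)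
  | realEq (v w : ℕ)
  | realLt (v w : ℕ)
  | neg (b : Test)
  | conj (b b' : Test)

def Test.Holds (s : State) : Test → Prop
  | .natEq v w => s.nat v = s.nat w
  | .natLt v w => s.nat v < s.nat w
  | .realEq v w => s.real v = s.real w
  | .realLt v w => s.real v < s.real w
  | .neg b => ¬ b.Holds s
  | .conj b b' => b.Holds s ∧ b'.Holds s

/-- The cost of a test is the number of comparisons and logical connectives in it. -/
def Test.cost : Test → ℕ
  | .natEq _ _ => 1
  | .natLt _ _ => 1
  | .realEq _ _ => 1
  | .realLt _ _ => 1
  | .neg b => b.cost + 1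
  | .conj b b' => b.cost + b'.cost + 1

/-- Programs. -/
inductive Program where
  | skip
  | instr (c : Instr)
  | seq (P Q : Program)
  | ite (b : Test) (P Q : Program)
  | loop (b : Test) (P : Program)

/-- `Exec P s t s'`: started in the memory `s`, the program `P` halts without a crash after exactly
`t` time units, with memory `s'`.  `loop b P` repeats `P` as long as `b` holds. -/
inductive Exec : Program → State → ℕ → State → Prop where
  | skip (s : State) : Exec .skip s 1 s
  | instr {c : Instr} {s s' : State} (h : c.step s = some s') : Exec (.instr c) s 1 s'
  | seq {P Q : Program} {s s' s'' : State} {t t' : ℕ}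
      (hP : Exec P s t s') (hQ : Exec Q s' t' s'') : Exec (.seq P Q) s (t + t') s''
  | iteTrue {b : Test} {P Q : Program} {s s' : State} {t : ℕ}
      (hb : b.Holds s) (hP : Exec P s t s') : Exec (.ite b P Q) s (b.cost + t) s'
  | iteFalse {b : Test} {P Q : Program} {s s' : State} {t : ℕ}
      (hb : ¬ b.Holds s) (hQ : Exec Q s t s') : Exec (.ite b P Q) s (b.cost + t) s'
  | loopTrue {b : Test} {P : Program} {s s' s'' : State} {t t' : ℕ}
      (hb : b.Holds s) (hP : Exec P s t s') (hL : Exec (.loop b P) s' t' s'') :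
      Exec (.loop b P) s (b.cost + t + t') s''
  | loopFalse {b : Test} {P : Program} {s : State}
      (hb : ¬ b.Holds s) : Exec (.loop b P) s b.cost s

/-- The machine is deterministic: running time and final memory are determined by the program and
the initial memory. -/
theorem Exec.deterministic {P : Program} {s s₁ s₂ : State} {t₁ t₂ : ℕ}
    (h₁ : Exec P s t₁ s₁) (h₂ : Exec P s t₂ s₂) : t₁ = t₂ ∧ s₁ = s₂ := by
  induction h₁ generalizing t₂ s₂ with
  | skip s => cases h₂; exact ⟨rfl, rfl⟩
  | instr h =>
    cases h₂ with
    | instr h' => exact ⟨rfl, Option.some.inj (h.symm.trans h')⟩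
  | seq _ _ ihP ihQ =>
    cases h₂ with
    | seq hP hQ =>
      obtain ⟨rfl, rfl⟩ := ihP hP
      obtain ⟨rfl, rfl⟩ := ihQ hQ
      exact ⟨rfl, rfl⟩
  | iteTrue hb _ ih =>
    cases h₂ with
    | iteTrue _ hP => obtain ⟨rfl, rfl⟩ := ih hP; exact ⟨rfl, rfl⟩
    | iteFalse hb' _ => exact absurd hb hb'
  | iteFalse hb _ ih =>
    cases h₂ with
    | iteTrue hb' _ => exact absurd hb' hb
    | iteFalse _ hQ => obtain ⟨rfl, rfl⟩ := ih hQ; exact ⟨rfl, rfl⟩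
  | loopTrue hb _ _ ihP ihL =>
    cases h₂ with
    | loopTrue _ hP hL =>
      obtain ⟨rfl, rfl⟩ := ihP hP
      obtain ⟨rfl, rfl⟩ := ihL hL
      exact ⟨rfl, rfl⟩
    | loopFalse hb' => exact absurd hb hb'
  | loopFalse hb =>
    cases h₂ with
    | loopTrue hb' _ _ => exact absurd hb' hb
    | loopFalse _ => exact ⟨rfl, rfl⟩

end RealRAM

/-! ### Largest minimum color-spanning intervals

An instance consists of the left endpoints `x i` of `n` closed unit segments and their colors
`color i`, which are taken from `k` colors. -/

namespace LMCSI

variable {n k : ℕ}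

/-- The `i`-th input segment. -/
def unitSegment (x : Fin n → ℝ) (i : Fin n) : Set ℝ := Set.Icc (x i) (x i + 1)

/-- A realization chooses one representative in each segment. -/
def IsRealization (x r : Fin n → ℝ) : Prop := ∀ i, r i ∈ unitSegment x i

/-- `[a, b]` is a color-spanning interval of the realization `r`: it contains a representative of
each color. -/
def IsColorSpanning (color : Fin n → Fin k) (r : Fin n → ℝ) (a b : ℝ) : Prop :=
  a ≤ b ∧ ∀ j : Fin k, ∃ i : Fin n, color i = j ∧ r i ∈ Set.Icc a b

/-- `q` is the length of the minimum color-spanning intervals of the realization `r`. -/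
def IsMCSILength (color : Fin n → Fin k) (r : Fin n → ℝ) (q : ℝ) : Prop :=
  IsLeast {l : ℝ | ∃ a b : ℝ, IsColorSpanning color r a b ∧ l = b - a} q

/-- `r` is a solution: a realization whose minimum color-spanning intervals are as long as
possible. -/
def IsSolution (x : Fin n → ℝ) (color : Fin n → Fin k) (r : Fin n → ℝ) : Prop :=
  IsRealization x r ∧ ∃ q : ℝ, IsMCSILength color r q ∧
    ∀ (r' : Fin n → ℝ) (q' : ℝ), IsRealization x r' → IsMCSILength color r' q' → q' ≤ q

/-- The memory holds the instance: `n` and `k` in integer registers `0` and `1`, the left endpoints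
in real array `0` and the colors (numbers below `k`) in integer array `0`.  The rest of the memory
may hold anything. -/
def HoldsInput (x : Fin n → ℝ) (color : Fin n → Fin k) (s : RealRAM.State) : Prop :=
  s.nat 0 = n ∧ s.nat 1 = k ∧
    ∀ i : Fin n, s.realArr 0 (i : ℕ) = x i ∧ s.natArr 0 (i : ℕ) = (color i : ℕ)

/-- The output is read from the first `n` cells of real array `1`. -/
def output (n : ℕ) (s : RealRAM.State) : Fin n → ℝ := fun i => s.realArr 1 (i : ℕ)

end LMCSI

/-! Since the segments are disjoint, every realization is increasing, and its MCSI is the shortest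
distance along one of the inclusion-minimal color-spanning windows `a, …, b` of segments (*links*).
No two links share an end, so the links form disjoint paths, and the task is to place the
representatives such that the smallest gap `L` along the links is as large as possible.

Concatenate the paths to one sequence of virtual positions `Y`, in which neighbors that are not
linked are so far apart (`B`) that their gap imposes no restriction.  Gaps of at least `L` are
possible if and only if `(t' - s) L ≤ Y t' + 1 - Y s` for all `s < t'`: the condition is necessary
by summation, and sufficient by greedy placement (`greedy`, `IsMinSlope.greedy_le`).  So the optimal
`L` is a minimum of slopes between the points `(s, Y s)` and `(t', Y t' + 1)`
(`isSolution_of_greedy`).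

All of this takes linear time.  The links are found by a scan with two pointers (`ScanInv`), the
paths are listed by following the links (`ListInv`), and the minimum slope is found with a queue
holding a concave chain of the points `(s, Y s)` (`HullInv`): since the current minimum `L` only
decreases, a front vertex whose slope to its successor is at least `L` is never needed again, and
neither is a back vertex below the line from its predecessor to the new point.  The program
consists of four loops without inner loops; each has a measure, linear in `n`, that every round
decreases (`Runs.block_loop`). -/

/-! ### Weakest preconditions for the machine -/

namespace RealRAM

@[simp] theorem State.setNat_nat (s : State) (v m : ℕ) :
    (s.setNat v m).nat = Function.update s.nat v m := rfl
@[simp] theorem State.setNat_real (s : State) (v m : ℕ) : (s.setNat v m).real = s.real := rfl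
@[simp] theorem State.setNat_natArr (s : State) (v m : ℕ) :
    (s.setNat v m).natArr = s.natArr := rfl
@[simp] theorem State.setNat_realArr (s : State) (v m : ℕ) :
    (s.setNat v m).realArr = s.realArr := rfl
@[simp] theorem State.setReal_nat (s : State) (v : ℕ) (y : ℝ) : (s.setReal v y).nat = s.nat := rfl
@[simp] theorem State.setReal_real (s : State) (v : ℕ) (y : ℝ) :
    (s.setReal v y).real = Function.update s.real v y := rfl
@[simp] theorem State.setReal_natArr (s : State) (v : ℕ) (y : ℝ) :
    (s.setReal v y).natArr = s.natArr := rfl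
@[simp] theorem State.setReal_realArr (s : State) (v : ℕ) (y : ℝ) :
    (s.setReal v y).realArr = s.realArr := rfl
@[simp] theorem State.setNatArr_nat (s : State) (a i m : ℕ) : (s.setNatArr a i m).nat = s.nat := rfl
@[simp] theorem State.setNatArr_real (s : State) (a i m : ℕ) :
    (s.setNatArr a i m).real = s.real := rfl
@[simp] theorem State.setNatArr_natArr (s : State) (a i m : ℕ) :
    (s.setNatArr a i m).natArr =
      Function.update s.natArr a (Function.update (s.natArr a) i m) := rfl
@[simp] theorem State.setNatArr_realArr (s : State) (a i m : ℕ) :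
    (s.setNatArr a i m).realArr = s.realArr := rfl
@[simp] theorem State.setRealArr_nat (s : State) (a i : ℕ) (y : ℝ) :
    (s.setRealArr a i y).nat = s.nat := rfl
@[simp] theorem State.setRealArr_real (s : State) (a i : ℕ) (y : ℝ) :
    (s.setRealArr a i y).real = s.real := rfl
@[simp] theorem State.setRealArr_natArr (s : State) (a i : ℕ) (y : ℝ) :
    (s.setRealArr a i y).natArr = s.natArr := rfl
@[simp] theorem State.setRealArr_realArr (s : State) (a i : ℕ) (y : ℝ) :
    (s.setRealArr a i y).realArr =
      Function.update s.realArr a (Function.update (s.realArr a) i y) := rfl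

/-- The worst-case running time of a program without loops (loops count as zero). -/
def Program.blockCost : Program → ℕ
  | .skip => 1
  | .instr _ => 1
  | .seq P Q => P.blockCost + Q.blockCost
  | .ite b P Q => b.cost + max P.blockCost Q.blockCost
  | .loop _ _ => 0

/-- The weakest precondition for a program without loops to halt without a crash in a memory
satisfying `Q`.  Loops get the precondition `False`; they are treated by `Runs.loop`. -/
def Program.wp : Program → (State → Prop) → State → Prop
  | .skip, Q, s => Q s
  | .instr c, Q, s => ∃ s', c.step s = some s' ∧ Q s'
  | .seq P R, Q, s => P.wp (R.wp Q) s
  | .ite b P R, Q, s => (b.Holds s → P.wp Q s) ∧ (¬ b.Holds s → R.wp Q s)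
  | .loop _ _, _, _ => False

/-- `Runs P s T Q`: started in the memory `s`, the program `P` halts without a crash after at most
`T` time units, in a memory satisfying `Q`. -/
def Runs (P : Program) (s : State) (T : ℕ) (Q : State → Prop) : Prop :=
  ∃ (t : ℕ) (s' : State), Exec P s t s' ∧ t ≤ T ∧ Q s'

theorem Runs.of_wp {P : Program} {Q : State → Prop} {s : State} (h : P.wp Q s) :
    Runs P s P.blockCost Q := by
  induction P generalizing Q s with
  | skip => exact ⟨1, s, .skip s, le_rfl, h⟩
  | instr c =>
    obtain ⟨s', hs, hQ⟩ := h
    exact ⟨1, s', .instr hs, le_rfl, hQ⟩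
  | seq P R ihP ihR =>
    obtain ⟨t, s', hP, ht, h'⟩ := ihP h
    obtain ⟨t', s'', hR, ht', hQ⟩ := ihR h'
    exact ⟨t + t', s'', .seq hP hR, add_le_add ht ht', hQ⟩
  | ite b P R ihP ihR =>
    by_cases hb : b.Holds s
    · obtain ⟨t, s', hP, ht, hQ⟩ := ihP (h.1 hb)
      exact ⟨_, s', .iteTrue hb hP, by simp only [Program.blockCost]; omega, hQ⟩
    · obtain ⟨t, s', hP, ht, hQ⟩ := ihR (h.2 hb)
      exact ⟨_, s', .iteFalse hb hP, by simp only [Program.blockCost]; omega, hQ⟩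
  | loop b P => exact h.elim

theorem Runs.seq {P R : Program} {s : State} {T T' : ℕ} {Q Q' : State → Prop}
    (hP : Runs P s T Q) (hR : ∀ s', Q s' → Runs R s' T' Q') : Runs (.seq P R) s (T + T') Q' := by
  obtain ⟨t, s', hP, ht, h'⟩ := hP
  obtain ⟨t', s'', hR, ht', hQ⟩ := hR s' h'
  exact ⟨t + t', s'', .seq hP hR, add_le_add ht ht', hQ⟩

theorem Runs.mono {P : Program} {s : State} {T T' : ℕ} {Q Q' : State → Prop}
    (h : Runs P s T Q) (hT : T ≤ T') (hQ : ∀ s', Q s' → Q' s') : Runs P s T' Q' := by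
  obtain ⟨t, s', hP, ht, h'⟩ := h
  exact ⟨t, s', hP, ht.trans hT, hQ s' h'⟩

/-- The rule for a loop with loop-free body: an invariant `I`, and a measure `μ` that each round
decreases and that therefore bounds the number of rounds. -/
theorem Runs.loop {b : Test} {P : Program} (I : State → Prop) (μ : State → ℕ)
    (step : ∀ s, I s → b.Holds s → P.wp (fun s' => I s' ∧ μ s' < μ s) s) {s : State} (hs : I s) :
    Runs (.loop b P) s ((μ s + 1) * (b.cost + P.blockCost)) (fun s' => I s' ∧ ¬ b.Holds s') := by
  induction h : μ s using Nat.strong_induction_on generalizing s with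
  | _ N ih =>
    by_cases hb : b.Holds s
    · obtain ⟨t, s', hP, ht, hI, hμ⟩ := Runs.of_wp (step s hs hb)
      obtain ⟨t', s'', hL, ht', hQ⟩ := ih _ (h ▸ hμ) hI rfl
      refine ⟨_, s'', .loopTrue hb hP hL, ?_, hQ⟩
      have h1 : (μ s' + 2) * (b.cost + P.blockCost) ≤ (N + 1) * (b.cost + P.blockCost) :=
        Nat.mul_le_mul_right _ (by omega)
      linarith [h1, ht, ht', show (μ s' + 2) * (b.cost + P.blockCost) =
        (μ s' + 1) * (b.cost + P.blockCost) + (b.cost + P.blockCost) by ring]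
    · exact ⟨_, s, .loopFalse hb, by nlinarith [Nat.zero_le (N * (b.cost + P.blockCost))],
        hs, hb⟩

end RealRAM

/-! ### Links: the minimal color-spanning windows -/

namespace LMCSI

/-- The segments with numbers `i, …, j` show all the colors `0, …, k - 1`. -/
def Spans (k : ℕ) (color : ℕ → ℕ) (i j : ℕ) : Prop :=
  ∀ c < k, ∃ i', i ≤ i' ∧ i' ≤ j ∧ color i' = c

/-- The links of an instance.  `nxt i = b ≠ 0` says that there is a link from `i` to `b`, and
`nxt i = 0` that there is none from `i` (no link ends in `0`); `hp b ≠ 0` says that some link ends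
in `b`.  Links are color-spanning windows of more than one segment, no two links share an end, and
every color-spanning window contains a link. -/
structure IsLinkTable (n k : ℕ) (color nxt hp : ℕ → ℕ) : Prop where
  link : ∀ i < n, nxt i ≠ 0 → i < nxt i ∧ nxt i < n ∧ Spans k color i (nxt i)
  inj : ∀ i < n, ∀ i' < n, nxt i = nxt i' → nxt i ≠ 0 → i = i'
  hasPrev : ∀ b < n, hp b ≠ 0 ↔ ∃ i < b, nxt i = b
  complete : 2 ≤ k → ∀ i b, b < n → Spans k color i b → ∃ a, i ≤ a ∧ a < b ∧ nxt a ≠ 0 ∧ nxt a ≤ b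

/-- The invariant of the two-pointer scan.  The windows ending before `j` have been treated, the
segments before `J` have been read, and `l` is the left pointer; `d` counts the colors met, and
`last c` is the last segment of color `c` that has been read.  Cells of `last` for colors not yet
met are never initialized. -/
structure ScanInv (k : ℕ) (color : ℕ → ℕ) (J j l d : ℕ) (last nxt hp : ℕ → ℕ) : Prop where
  le : l ≤ j
  le' : j ≤ J
  seen : ∀ i < J, i ≤ last (color i) ∧ last (color i) < J ∧ color (last (color i)) = color i
  count : d = ((Finset.range J).image color).card
  drop : ∀ i < l, ∃ i', l ≤ i' ∧ i' < J ∧ color i' = color i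
  link : ∀ i < J, nxt i ≠ 0 → i < nxt i ∧ nxt i < j ∧ Spans k color i (nxt i)
  inj : ∀ i < J, ∀ i' < J, nxt i = nxt i' → nxt i ≠ 0 → i = i'
  hasPrev : ∀ b < J, hp b ≠ 0 ↔ ∃ i < b, nxt i = b
  complete : 2 ≤ k → ∀ i b, b < j → Spans k color i b → ∃ a, i ≤ a ∧ a < b ∧ nxt a ≠ 0 ∧ nxt a ≤ b

theorem ScanInv.start (k : ℕ) (color last nxt hp : ℕ → ℕ) :
    ScanInv k color 0 0 0 0 last nxt hp := by
  constructor <;> simp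

section
open Function (update)
variable {k : ℕ} {color : ℕ → ℕ} {j l d : ℕ} {last nxt hp : ℕ → ℕ}

/-- A cell of the uninitialized array `last` certifies that its color has been met exactly if it
holds a number below `j` of a segment of that color. -/
theorem ScanInv.count_succ (h : ScanInv k color j j l d last nxt hp) :
    (if last (color j) < j ∧ color (last (color j)) = color j then d else d + 1) =
      ((Finset.range (j + 1)).image color).card := by
  rw [Finset.range_add_one, Finset.image_insert, h.count]
  split_ifs with hc
  · rw [Finset.insert_eq_of_mem]
    exact Finset.mem_image.2 ⟨_, Finset.mem_range.2 hc.1, hc.2⟩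
  · rw [Finset.card_insert_of_notMem]
    intro hm
    obtain ⟨i, hi, hic⟩ := Finset.mem_image.1 hm
    have := h.seen i (Finset.mem_range.1 hi)
    rw [hic] at this
    exact hc ⟨this.2.1, this.2.2⟩

theorem ScanInv.read (h : ScanInv k color j j l d last nxt hp) {d' : ℕ}
    (hd : d' = if last (color j) < j ∧ color (last (color j)) = color j then d else d + 1) :
    ScanInv k color (j + 1) j l d' (update last (color j) j) (update nxt j 0) (update hp j 0) where
  le := h.le
  le' := by omega
  count := hd.trans h.count_succ
  seen i hi := by
    by_cases hc : color i = color j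
    · rw [hc]; simp; omega
    · have : i < j := by
        rcases Nat.lt_succ_iff_lt_or_eq.1 hi with h | rfl
        · exact h
        · exact absurd rfl hc
      have := h.seen i this
      rw [Function.update_of_ne hc]
      exact ⟨this.1, by omega, this.2.2⟩
  drop i hi := by
    obtain ⟨i', h1, h2, h3⟩ := h.drop i hi
    exact ⟨i', h1, by omega, h3⟩
  link i hi hn := by
    by_cases hij : i = j
    · subst hij; simp at hn
    · rw [Function.update_of_ne hij] at hn ⊢
      exact h.link i (by omega) hn
  inj i hi i' hi' he hn := by
    by_cases hij : i = j
    · subst hij; simp at hn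
    by_cases hij' : i' = j
    · subst hij'; simp at he; exact absurd he hn
    rw [Function.update_of_ne hij] at hn he
    rw [Function.update_of_ne hij'] at he
    exact h.inj i (by omega) i' (by omega) he hn
  hasPrev b hb := by
    by_cases hbj : b = j
    · subst hbj
      simp only [Function.update_self, ne_eq, not_true_eq_false, false_iff]
      rintro ⟨i, hi, he⟩
      rw [Function.update_of_ne (by omega)] at he
      have := h.link i hi (by omega)
      omega
    · rw [Function.update_of_ne hbj, h.hasPrev b (by omega)]
      refine exists_congr fun i => and_congr_right fun hi => ?_
      rw [Function.update_of_ne (by omega)]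
  complete hk i b hb hs := by
    obtain ⟨a, h1, h2, h3, h4⟩ := h.complete hk i b hb hs
    refine ⟨a, h1, h2, ?_⟩
    rw [Function.update_of_ne (by omega)]
    exact ⟨h3, h4⟩

theorem ScanInv.advance (h : ScanInv k color (j + 1) j l d last nxt hp)
    (hl : last (color l) ≠ l) : ScanInv k color (j + 1) j (l + 1) d last nxt hp where
  __ := h
  le := by
    have := h.seen l (by have := h.le; omega)
    omega
  drop i hi := by
    have hll := h.seen l (by have := h.le; omega)
    rcases Nat.lt_succ_iff_lt_or_eq.1 hi with hi | rfl
    · obtain ⟨i', h1, h2, h3⟩ := h.drop i hi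
      by_cases he : i' = l
      · subst he
        exact ⟨last (color i'), by omega, hll.2.1, hll.2.2.trans h3⟩
      · exact ⟨i', by omega, h2, h3⟩
    · exact ⟨last (color i), by omega, hll.2.1, hll.2.2⟩

theorem ScanInv.spans_iff (h : ScanInv k color (j + 1) j l d last nxt hp)
    (hcol : ∀ i ≤ j, color i < k) : Spans k color l j ↔ d = k := by
  have hsub : (Finset.range (j + 1)).image color ⊆ Finset.range k := by
    intro c hc
    obtain ⟨i, hi, rfl⟩ := Finset.mem_image.1 hc
    exact Finset.mem_range.2 (hcol i (by simpa [Nat.lt_succ_iff] using hi))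
  constructor
  · intro hs
    rw [h.count, ← Finset.card_range k]
    congr 1
    refine hsub.antisymm fun c hc => ?_
    obtain ⟨i, h1, h2, h3⟩ := hs c (Finset.mem_range.1 hc)
    exact Finset.mem_image.2 ⟨i, Finset.mem_range.2 (by omega), h3⟩
  · intro hd c hc
    have heq := Finset.eq_of_subset_of_card_le hsub (by rw [← h.count, hd, Finset.card_range])
    have hm : c ∈ (Finset.range (j + 1)).image color := heq ▸ Finset.mem_range.2 hc
    obtain ⟨i, hi, rfl⟩ := Finset.mem_image.1 hm
    have hi := Finset.mem_range.1 hi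
    by_cases hil : i < l
    · obtain ⟨i', h1, h2, h3⟩ := h.drop i hil
      exact ⟨i', h1, by omega, h3⟩
    · exact ⟨i, by omega, by omega, rfl⟩

/-- When the left pointer cannot be advanced, a spanning window ending in `j` starts at `l` or
before, and the window from `l` to `j` is spanning as well. -/
theorem ScanInv.le_of_spans (h : ScanInv k color (j + 1) j l d last nxt hp)
    (hcol : ∀ i ≤ j, color i < k) (hl : last (color l) = l) {i : ℕ} (hs : Spans k color i j) :
    i ≤ l ∧ Spans k color l j := by
  constructor
  · obtain ⟨i', h1, h2, h3⟩ := hs (color l) (hcol l h.le)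
    have := (h.seen i' (by omega)).1
    rw [h3, hl] at this
    omega
  · intro c hc
    obtain ⟨i', h1, h2, h3⟩ := hs c hc
    by_cases hil : i' < l
    · obtain ⟨i'', g1, g2, g3⟩ := h.drop i' hil
      exact ⟨i'', g1, by omega, g3.trans h3⟩
    · exact ⟨i', by omega, h2, h3⟩

theorem Spans.lt_of_two_le (hs : Spans k color l j) (hk : 2 ≤ k) : l < j := by
  obtain ⟨i, h1, h2, h3⟩ := hs 0 (by omega)
  obtain ⟨i', h1', h2', h3'⟩ := hs 1 (by omega)
  by_contra hlt
  have : i = i' := by omega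
  subst this
  omega

theorem ScanInv.skip (h : ScanInv k color (j + 1) j l d last nxt hp)
    (hcol : ∀ i ≤ j, color i < k) (hl : last (color l) = l)
    (hc : ¬ (d = k ∧ nxt l = 0 ∧ l < j)) : ScanInv k color (j + 1) (j + 1) l d last nxt hp where
  __ := h
  le := by have := h.le; omega
  le' := le_rfl
  link i hi hn := by
    have := h.link i hi hn
    exact ⟨this.1, by omega, this.2.2⟩
  complete hk i b hb hs := by
    rcases Nat.lt_succ_iff_lt_or_eq.1 hb with hb | rfl
    · exact h.complete hk i b hb hs
    · obtain ⟨hil, hls⟩ := h.le_of_spans hcol hl hs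
      have hlt := hls.lt_of_two_le hk
      have hn : nxt l ≠ 0 := fun hn => hc ⟨(h.spans_iff hcol).1 hls, hn, hlt⟩
      exact ⟨l, hil, hlt, hn, (h.link l (by omega) hn).2.1.le⟩

theorem ScanInv.record (h : ScanInv k color (j + 1) j l d last nxt hp)
    (hcol : ∀ i ≤ j, color i < k) (hl : last (color l) = l)
    (hd : d = k) (hn : nxt l = 0) (hlj : l < j) :
    ScanInv k color (j + 1) (j + 1) l d last (update nxt l j) (update hp j 1) where
  le := by omega
  le' := le_rfl
  seen := h.seen
  count := h.count
  drop := h.drop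
  link i hi hi0 := by
    by_cases hil : i = l
    · subst hil
      simp only [Function.update_self]
      exact ⟨hlj, by omega, (h.spans_iff hcol).2 hd⟩
    · rw [Function.update_of_ne hil] at hi0 ⊢
      have := h.link i hi hi0
      exact ⟨this.1, by omega, this.2.2⟩
  inj i hi i' hi' he hi0 := by
    by_cases hil : i = l <;> by_cases hil' : i' = l
    · omega
    · subst hil
      rw [Function.update_self, Function.update_of_ne hil'] at he
      have := h.link i' hi' (by omega)
      omega
    · subst hil'
      rw [Function.update_self, Function.update_of_ne hil] at he
      have := h.link i hi (by omega)
      omega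
    · rw [Function.update_of_ne hil] at hi0
      rw [Function.update_of_ne hil, Function.update_of_ne hil'] at he
      exact h.inj i hi i' hi' he hi0
  hasPrev b hb := by
    by_cases hbj : b = j
    · subst hbj
      simp only [Function.update_self, ne_eq, one_ne_zero, not_false_eq_true, true_iff]
      exact ⟨l, hlj, by simp⟩
    · rw [Function.update_of_ne hbj, h.hasPrev b hb]
      refine exists_congr fun i => and_congr_right fun hi => ?_
      by_cases hil : i = l
      · subst hil
        rw [Function.update_self, hn]
        omega
      · rw [Function.update_of_ne hil]
  complete hk i b hb hs := by
    rcases Nat.lt_succ_iff_lt_or_eq.1 hb with hb | rfl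
    · obtain ⟨a, h1, h2, h3, h4⟩ := h.complete hk i b hb hs
      refine ⟨a, h1, h2, ?_⟩
      have hal : a ≠ l := fun hal => h3 (hal ▸ hn)
      rw [Function.update_of_ne hal]
      exact ⟨h3, h4⟩
    · obtain ⟨hil, hls⟩ := h.le_of_spans hcol hl hs
      exact ⟨l, hil, hlj, by simp; omega⟩

theorem ScanInv.isLinkTable {n : ℕ} (h : ScanInv k color n n l d last nxt hp) :
    IsLinkTable n k color nxt hp :=
  ⟨h.link, h.inj, h.hasPrev, h.complete⟩

end

end LMCSI

/-! ### Concatenating the paths formed by the links -/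

namespace LMCSI

/-- `q` and `Y` with length `m` are a list of all segments in which each link joins two
neighbors, together with virtual positions: the positions differ like the left endpoints along
links, and by `B` between neighbors that are not linked. -/
structure IsPathList (n : ℕ) (x : ℕ → ℝ) (nxt : ℕ → ℕ) (B : ℝ) (m : ℕ) (q : ℕ → ℕ) (Y : ℕ → ℝ) :
    Prop where
  lt : ∀ t < m, q t < n
  inj : ∀ t < m, ∀ t' < m, q t = q t' → t = t'
  surj : ∀ v < n, ∃ t < m, q t = v
  gap : ∀ t, t + 1 < m → (nxt (q t) = q (t + 1) ∧ nxt (q t) ≠ 0 ∧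
    Y (t + 1) - Y t = x (q (t + 1)) - x (q t)) ∨ Y (t + 1) - Y t = B
  linked : ∀ t < m, nxt (q t) ≠ 0 → t + 1 < m ∧ q (t + 1) = nxt (q t) ∧
    Y (t + 1) - Y t = x (q (t + 1)) - x (q t)

/-- The invariant of the concatenation.  The starts of paths below `p` have been met, `m` segments
have been listed, the last of them being `u` at virtual position `y`, and `c` is its successor on
the path; `c = 0` means that there is none, and that the search for another start goes on. -/
structure ListInv (n : ℕ) (x : ℕ → ℝ) (nxt hp : ℕ → ℕ) (B : ℝ) (p c m u : ℕ) (y : ℝ)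
    (q : ℕ → ℕ) (Y : ℕ → ℝ) : Prop where
  le : p ≤ n
  lt : ∀ t < m, q t < n
  inj : ∀ t < m, ∀ t' < m, q t = q t' → t = t'
  gap : ∀ t, t + 1 < m → (nxt (q t) = q (t + 1) ∧ nxt (q t) ≠ 0 ∧
    Y (t + 1) - Y t = x (q (t + 1)) - x (q t)) ∨
      (hp (q (t + 1)) = 0 ∧ Y (t + 1) - Y t = B)
  linked : ∀ t, t + 1 < m → nxt (q t) ≠ 0 → q (t + 1) = nxt (q t) ∧
    Y (t + 1) - Y t = x (q (t + 1)) - x (q t)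
  final : ∀ t, t + 1 = m → q t = u ∧ Y t = y ∧ c = nxt u
  pos : c ≠ 0 → 0 < m ∧ p < n
  first : 0 < m → hp (q 0) = 0
  start : ∀ v < p, hp v = 0 → ∃ t < m, q t = v
  start' : ∀ t < m, hp (q t) = 0 → q t < p

section
open Function (update)
variable {n k : ℕ} {x : ℕ → ℝ} {color nxt hp : ℕ → ℕ} {B : ℝ} {p c m u : ℕ} {y : ℝ}
  {q : ℕ → ℕ} {Y : ℕ → ℝ}

theorem ListInv.init (n : ℕ) (x : ℕ → ℝ) (nxt hp : ℕ → ℕ) (B : ℝ) (u : ℕ) (y : ℝ)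
    (q : ℕ → ℕ) (Y : ℕ → ℝ) : ListInv n x nxt hp B 0 0 0 u y q Y := by
  constructor <;> simp

theorem ListInv.length_le (h : ListInv n x nxt hp B p c m u y q Y) : m ≤ n := by
  have := Finset.card_le_card_of_injOn (s := Finset.range m) (t := Finset.range n) q
    (fun t ht => by simpa using h.lt t (by simpa using ht))
    (fun t ht t' ht' he => h.inj t (by simpa using ht) t' (by simpa using ht') he)
  simpa using this

theorem ListInv.next (h : ListInv n x nxt hp B p c m u y q Y) (hp0 : p < n) (hc : c = 0)
    (hr : hp p ≠ 0) :
    ListInv n x nxt hp B (p + 1) c m u y q Y where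
  __ := h
  le := hp0
  pos hc' := absurd hc hc'
  start v hv hv0 := h.start v (by
    rcases Nat.lt_succ_iff_lt_or_eq.1 hv with hv | rfl
    · exact hv
    · exact absurd hv0 hr) hv0
  start' t ht h0 := (h.start' t ht h0).trans (Nat.lt_succ_self p)

theorem ListInv.begin (ht : IsLinkTable n k color nxt hp)
    (h : ListInv n x nxt hp B p c m u y q Y) (hp0 : p < n) (hc : c = 0) (hr : hp p = 0) :
    ListInv n x nxt hp B (p + 1) (nxt p) (m + 1) p (y + B) (update q m p) (update Y m (y + B)) where
  le := hp0
  lt t ht := by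
    by_cases htm : t = m
    · subst htm; simpa
    · rw [Function.update_of_ne htm]; exact h.lt t (by omega)
  inj t ht t' ht' he := by
    by_cases htm : t = m <;> by_cases htm' : t' = m
    · omega
    · subst htm
      rw [Function.update_self, Function.update_of_ne htm'] at he
      have := h.start' t' (by omega) (he ▸ hr)
      omega
    · subst htm'
      rw [Function.update_self, Function.update_of_ne htm] at he
      have := h.start' t (by omega) (he ▸ hr)
      omega
    · rw [Function.update_of_ne htm, Function.update_of_ne htm'] at he
      exact h.inj t (by omega) t' (by omega) he
  gap t ht := by
    by_cases htm : t + 1 = m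
    · subst htm
      have := h.final t rfl
      right
      rw [Function.update_self, Function.update_self, Function.update_of_ne (by omega), this.2.1]
      exact ⟨hr, by ring⟩
    · rw [Function.update_of_ne htm, Function.update_of_ne htm, Function.update_of_ne (by omega),
        Function.update_of_ne (by omega)]
      exact h.gap t (by omega)
  linked t ht hn := by
    by_cases htm : t + 1 = m
    · subst htm
      have := h.final t rfl
      rw [Function.update_of_ne (by omega), this.1, ← this.2.2] at hn
      exact absurd hc hn
    · rw [Function.update_of_ne (by omega)] at hn
      rw [Function.update_of_ne htm, Function.update_of_ne htm, Function.update_of_ne (by omega),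
        Function.update_of_ne (by omega)]
      exact h.linked t (by omega) hn
  final t ht := by
    obtain rfl : t = m := by omega
    simp
  pos hc' := by
    have := ht.link p hp0 hc'
    omega
  first _ := by
    by_cases hm : 0 = m
    · subst hm; simpa
    · rw [Function.update_of_ne hm]; exact h.first (by omega)
  start v hv hv0 := by
    rcases Nat.lt_succ_iff_lt_or_eq.1 hv with hv | rfl
    · obtain ⟨t, ht, rfl⟩ := h.start v hv hv0
      exact ⟨t, by omega, by rw [Function.update_of_ne (by omega)]⟩
    · exact ⟨m, by omega, by simp⟩
  start' t ht h0 := by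
    by_cases htm : t = m
    · subst htm; simp
    · rw [Function.update_of_ne htm] at h0 ⊢
      exact (h.start' t (by omega) h0).trans (Nat.lt_succ_self p)

theorem ListInv.follow (ht : IsLinkTable n k color nxt hp)
    (h : ListInv n x nxt hp B p c m u y q Y) (hc : c ≠ 0) :
    ListInv n x nxt hp B p (nxt c) (m + 1) c (y + (x c - x u)) (update q m c)
      (update Y m (y + (x c - x u))) := by
  obtain ⟨hm, hpn⟩ := h.pos hc
  obtain ⟨hu, hy, hcu⟩ := h.final (m - 1) (by omega)
  have hun : u < n := hu ▸ h.lt _ (by omega)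
  obtain ⟨huc, hcn, -⟩ := ht.link u hun (hcu ▸ hc)
  rw [← hcu] at huc hcn
  have hpc : hp c ≠ 0 := (ht.hasPrev c hcn).2 ⟨u, huc, hcu.symm⟩
  -- A listed segment that has a predecessor is preceded by it in the list.
  have hnew : ∀ t < m, q t ≠ c := by
    intro t htm he
    rcases Nat.eq_zero_or_pos t with rfl | htpos
    · exact hpc (he ▸ h.first hm)
    · obtain ⟨t, rfl⟩ := Nat.exists_eq_add_of_lt htpos
      simp only [zero_add] at *
      rcases h.gap t htm with ⟨h1, h2, -⟩ | ⟨h1, -⟩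
      · have := ht.inj _ (h.lt t (by omega)) u hun (by rw [h1, he, hcu]) h2
        have := h.inj t (by omega) (m - 1) (by omega) (this.trans hu.symm)
        omega
      · exact hpc (he ▸ h1)
  refine ⟨h.le, ?_, ?_, ?_, ?_, ?_, ?_, ?_, ?_, ?_⟩
  · intro t ht
    by_cases htm : t = m
    · subst htm; simpa
    · rw [Function.update_of_ne htm]; exact h.lt t (by omega)
  · intro t ht t' ht' he
    by_cases htm : t = m <;> by_cases htm' : t' = m
    · omega
    · subst htm
      rw [Function.update_self, Function.update_of_ne htm'] at he
      exact absurd he.symm (hnew t' (by omega))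
    · subst htm'
      rw [Function.update_self, Function.update_of_ne htm] at he
      exact absurd he (hnew t (by omega))
    · rw [Function.update_of_ne htm, Function.update_of_ne htm'] at he
      exact h.inj t (by omega) t' (by omega) he
  · intro t ht
    by_cases htm : t + 1 = m
    · subst htm
      left
      rw [Function.update_self, Function.update_self, Function.update_of_ne (by omega),
        Function.update_of_ne (by omega)]
      simp only [Nat.add_sub_cancel] at hu hy
      rw [hu, hy, ← hcu]
      exact ⟨rfl, hc, by ring⟩
    · rw [Function.update_of_ne htm, Function.update_of_ne htm, Function.update_of_ne (by omega),
        Function.update_of_ne (by omega)]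
      exact h.gap t (by omega)
  · intro t ht hn
    by_cases htm : t + 1 = m
    · subst htm
      rw [Function.update_self, Function.update_self, Function.update_of_ne (by omega),
        Function.update_of_ne (by omega)]
      simp only [Nat.add_sub_cancel] at hu hy
      rw [hu, hy, ← hcu]
      exact ⟨rfl, by ring⟩
    · rw [Function.update_of_ne (by omega)] at hn
      rw [Function.update_of_ne htm, Function.update_of_ne htm, Function.update_of_ne (by omega),
        Function.update_of_ne (by omega)]
      exact h.linked t (by omega) hn
  · intro t ht
    obtain rfl : t = m := by omega
    simp
  · exact fun _ => ⟨by omega, hpn⟩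
  · intro _
    rw [Function.update_of_ne (by omega)]
    exact h.first hm
  · intro v hv hv0
    obtain ⟨t, ht, rfl⟩ := h.start v hv hv0
    exact ⟨t, by omega, by rw [Function.update_of_ne (by omega)]⟩
  · intro t ht h0
    by_cases htm : t = m
    · subst htm; rw [Function.update_self] at h0; exact absurd h0 hpc
    · rw [Function.update_of_ne htm] at h0 ⊢
      exact h.start' t (by omega) h0

theorem ListInv.isPathList (ht : IsLinkTable n k color nxt hp)
    (h : ListInv n x nxt hp B n c m u y q Y) : IsPathList n x nxt B m q Y := by
  have hc : c = 0 := by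
    by_contra hc
    exact lt_irrefl _ (h.pos hc).2
  have hl : ∀ t < m, nxt (q t) ≠ 0 → t + 1 < m ∧ q (t + 1) = nxt (q t) ∧
      Y (t + 1) - Y t = x (q (t + 1)) - x (q t) := by
    intro t htm hn
    have htm' : t + 1 < m := by
      by_contra hge
      obtain ⟨h1, -, h3⟩ := h.final t (by omega)
      rw [h1, ← h3] at hn
      exact hn hc
    exact ⟨htm', h.linked t htm' hn⟩
  refine ⟨h.lt, h.inj, fun v => ?_, fun t ht => (h.gap t ht).imp id And.right, hl⟩
  induction v using Nat.strong_induction_on with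
  | _ v ih =>
    intro hv
    by_cases hv0 : hp v = 0
    · exact h.start v hv hv0
    · obtain ⟨i, hi, rfl⟩ := (ht.hasPrev v hv).1 hv0
      obtain ⟨t, htm, rfl⟩ := ih i hi (hi.trans hv)
      obtain ⟨h1, h2, -⟩ := hl t htm (by omega)
      exact ⟨t + 1, h1, h2⟩

end

end LMCSI

/-! ### The minimum slope -/

namespace LMCSI

/-- `L` is `B` or one of the slopes `(Y t' + 1 - Y s) / (t' - s)` with `s < t' < m`, and none of
these slopes is smaller than `L`. -/
structure IsMinSlope (m : ℕ) (Y : ℕ → ℝ) (B L : ℝ) : Prop where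
  attained : L = B ∨ ∃ s t', s < t' ∧ t' < m ∧ Y t' + 1 - Y s = ((t' : ℝ) - s) * L
  le : ∀ s t', s < t' → t' < m → ((t' : ℝ) - s) * L ≤ Y t' + 1 - Y s

/-- The invariant of the computation of the minimum slope, common to its two modes.  `L` is not
larger than the slopes of the pairs with `t' < T`.  Cells `f, …, e - 1` of the array `D` hold, from
left to right, the numbers of vertices `(s, Y s)`, `s < t`, of a concave chain. -/
structure HullInv (m : ℕ) (Y : ℕ → ℝ) (B L : ℝ) (t T f e : ℕ) (D : ℕ → ℕ) : Prop where
  pos : 0 < t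
  attained : L = B ∨ ∃ s t', s < t' ∧ t' < m ∧ Y t' + 1 - Y s = ((t' : ℝ) - s) * L
  le : ∀ s t', s < t' → t' < T → ((t' : ℝ) - s) * L ≤ Y t' + 1 - Y s
  nonempty : f < e
  vertex_lt : ∀ a, f ≤ a → a < e → D a < t
  sorted : ∀ a, f ≤ a → a + 1 < e → D a < D (a + 1)
  concave : ∀ a, f ≤ a → a + 2 < e →
    (Y (D (a + 2)) - Y (D (a + 1))) * ((D (a + 1) : ℝ) - D a) ≤
      (Y (D (a + 1)) - Y (D a)) * ((D (a + 2) : ℝ) - D (a + 1))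

/-- The point with number `s` lies on or below a line of slope `μ` through one of the vertices. -/
def Covered (Y : ℕ → ℝ) (f e : ℕ) (D : ℕ → ℕ) (μ : ℝ) (s : ℕ) : Prop :=
  ∃ a, f ≤ a ∧ a < e ∧ Y s - s * μ ≤ Y (D a) - D a * μ

/-- The invariant while the front of the chain is trimmed: for all slopes up to `L`, every point is
covered by a vertex of the chain. -/
structure FrontInv (m : ℕ) (Y : ℕ → ℝ) (B L : ℝ) (t f e : ℕ) (D : ℕ → ℕ) : Prop extends
    HullInv m Y B L t t f e D where
  cover : ∀ s < t, ∀ μ ≤ L, Covered Y f e D μ s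

/-- The invariant while vertices are removed at the back of the chain to make room for the point
with number `t`. -/
structure BackInv (m : ℕ) (Y : ℕ → ℝ) (B L : ℝ) (t f e : ℕ) (D : ℕ → ℕ) : Prop extends
    HullInv m Y B L t (t + 1) f e D where
  cover : ∀ s < t + 1, ∀ μ ≤ L, Covered Y f e D μ s ∨ Y s - s * μ ≤ Y t - t * μ

section
open Function (update)
variable {m : ℕ} {Y : ℕ → ℝ} {B L : ℝ} {t T f e : ℕ} {D : ℕ → ℕ}

theorem FrontInv.start (hD : D 0 = 0) : FrontInv m Y B B 1 0 1 D where
  pos := Nat.one_pos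
  attained := .inl rfl
  le s t' h1 h2 := by omega
  nonempty := Nat.one_pos
  vertex_lt a _ ha := by
    obtain rfl : a = 0 := by omega
    omega
  sorted a _ ha := by omega
  concave a _ ha := by omega
  cover s hs μ _ := by
    obtain rfl : s = 0 := by omega
    exact ⟨0, le_rfl, Nat.one_pos, by rw [hD]⟩

theorem HullInv.sub_pos (h : HullInv m Y B L t T f e D) : (0 : ℝ) < (t : ℝ) - D f := by
  have : (D f : ℝ) < t := by exact_mod_cast h.vertex_lt f le_rfl h.nonempty
  linarith

theorem FrontInv.lower (h : FrontInv m Y B L t f e D) (ht : t < m)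
    (hL : (Y t + 1 - Y (D f)) / ((t : ℝ) - D f) < L) :
    FrontInv m Y B ((Y t + 1 - Y (D f)) / ((t : ℝ) - D f)) t f e D where
  __ := h
  attained := .inr ⟨D f, t, h.vertex_lt f le_rfl h.nonempty, ht, by
    rw [mul_div_cancel₀ _ h.sub_pos.ne']⟩
  le s t' hs ht' := by
    refine le_trans ?_ (h.le s t' hs ht')
    have : (s : ℝ) < t' := by exact_mod_cast hs
    exact mul_le_mul_of_nonneg_left hL.le (by linarith)
  cover s hs μ hμ := h.cover s hs μ (hμ.trans hL.le)

theorem FrontInv.popFront (h : FrontInv m Y B L t f e D) (hf : f + 1 < e)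
    (hL : ((D (f + 1) : ℝ) - D f) * L ≤ Y (D (f + 1)) - Y (D f)) :
    FrontInv m Y B L t (f + 1) e D where
  pos := h.pos
  attained := h.attained
  le := h.le
  nonempty := hf
  vertex_lt a ha := h.vertex_lt a (by omega)
  sorted a ha := h.sorted a (by omega)
  concave a ha := h.concave a (by omega)
  cover s hs μ hμ := by
    obtain ⟨a, h1, h2, h3⟩ := h.cover s hs μ hμ
    by_cases ha : a = f
    · subst ha
      refine ⟨a + 1, le_rfl, hf, h3.trans ?_⟩
      have : (D a : ℝ) < D (a + 1) := by exact_mod_cast h.sorted a le_rfl hf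
      nlinarith
    · exact ⟨a, by omega, h2, h3⟩

/-- By concavity, a slope below `L` at the front is below `L` along the whole chain. -/
theorem HullInv.slope_lt (h : HullInv m Y B L t T f e D)
    (hL : f + 1 < e → Y (D (f + 1)) - Y (D f) < ((D (f + 1) : ℝ) - D f) * L) :
    ∀ a, f ≤ a → a + 1 < e → Y (D (a + 1)) - Y (D a) < ((D (a + 1) : ℝ) - D a) * L := by
  intro a ha
  induction a, ha using Nat.le_induction with
  | base => exact hL
  | succ a ha ih =>
    intro hae
    have h0 := ih (by omega)
    have h1 := h.concave a ha hae
    have h2 : (D a : ℝ) < D (a + 1) := by exact_mod_cast h.sorted a ha (by omega)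
    have h3 : (D (a + 1) : ℝ) < D (a + 1 + 1) := by exact_mod_cast h.sorted (a + 1) (by omega) hae
    have h4 : (Y (D (a + 1)) - Y (D a)) * ((D (a + 1 + 1) : ℝ) - D (a + 1)) <
        (((D (a + 1) : ℝ) - D a) * L) * ((D (a + 1 + 1) : ℝ) - D (a + 1)) :=
      mul_lt_mul_of_pos_right h0 (by linarith)
    have h5 : (Y (D (a + 2)) - Y (D (a + 1))) * ((D (a + 1) : ℝ) - D a) <
        (((D (a + 1 + 1) : ℝ) - D (a + 1)) * L) * ((D (a + 1) : ℝ) - D a) := by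
      refine h1.trans_lt (h4.trans_eq ?_)
      ring
    exact lt_of_mul_lt_mul_right h5 (by linarith)

theorem HullInv.vertex_le (h : HullInv m Y B L t T f e D)
    (hL : f + 1 < e → Y (D (f + 1)) - Y (D f) < ((D (f + 1) : ℝ) - D f) * L) :
    ∀ a, f ≤ a → a < e → Y (D a) - D a * L ≤ Y (D f) - D f * L := by
  intro a ha
  induction a, ha using Nat.le_induction with
  | base => exact fun _ => le_rfl
  | succ a ha ih =>
    intro hae
    have := h.slope_lt hL a ha hae
    have := ih (by omega)
    linarith

/-- Once the slope at the front is below `L`, the front vertex maximizes `Y s - s L` among all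
points before `t`; so if the slope from it to `(t, Y t + 1)` is at least `L`, then so are those from
the other points. -/
theorem FrontInv.toBack (h : FrontInv m Y B L t f e D)
    (hf : ((t : ℝ) - D f) * L ≤ Y t + 1 - Y (D f))
    (hL : f + 1 < e → Y (D (f + 1)) - Y (D f) < ((D (f + 1) : ℝ) - D f) * L) :
    BackInv m Y B L t f e D where
  __ := h
  le s t' hs ht' := by
    rcases Nat.lt_succ_iff_lt_or_eq.1 ht' with ht' | rfl
    · exact h.le s t' hs ht'
    · obtain ⟨a, h1, h2, h3⟩ := h.cover s hs L le_rfl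
      have := h.vertex_le hL a h1 h2
      linarith
  cover s hs μ hμ := by
    rcases Nat.lt_succ_iff_lt_or_eq.1 hs with hs | rfl
    · exact .inl (h.cover s hs μ hμ)
    · exact .inr le_rfl

theorem BackInv.popBack (h : BackInv m Y B L t f e D) (hf : f < e - 1)
    (hc : (Y (D (e - 1)) - Y (D (e - 1 - 1))) * ((t : ℝ) - D (e - 1)) ≤
      (Y t - Y (D (e - 1))) * ((D (e - 1) : ℝ) - D (e - 1 - 1))) :
    BackInv m Y B L t f (e - 1) D where
  pos := h.pos
  attained := h.attained
  le := h.le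
  nonempty := hf
  vertex_lt a ha ha' := h.vertex_lt a ha (by omega)
  sorted a ha ha' := h.sorted a ha (by omega)
  concave a ha ha' := h.concave a ha (by omega)
  cover s hs μ hμ := by
    rcases h.cover s hs μ hμ with ⟨a, h1, h2, h3⟩ | h
    · by_cases ha : a = e - 1
      · obtain ⟨b, rfl⟩ : ∃ b, e = b + 2 := ⟨e - 2, by omega⟩
        simp only [Nat.add_succ_sub_one, Nat.add_sub_cancel] at *
        subst ha
        have h4 : (D b : ℝ) < D (b + 1) := by exact_mod_cast h.sorted b (by omega) (by omega)
        have h5 : (D (b + 1) : ℝ) < t := by exact_mod_cast h.vertex_lt (b + 1) h1 h2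
        -- The removed vertex is covered by `t` for small slopes, by its predecessor for large ones.
        by_cases hμ' : ((t : ℝ) - D (b + 1)) * μ ≤ Y t - Y (D (b + 1))
        · right
          linarith
        · left
          refine ⟨b, by omega, by omega, h3.trans ?_⟩
          push Not at hμ'
          have h6 : (Y t - Y (D (b + 1))) * ((D (b + 1) : ℝ) - D b) <
              (((t : ℝ) - D (b + 1)) * μ) * ((D (b + 1) : ℝ) - D b) :=
            mul_lt_mul_of_pos_right hμ' (by linarith)
          have h7 : (Y (D (b + 1)) - Y (D b)) * ((t : ℝ) - D (b + 1)) <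
              (((D (b + 1) : ℝ) - D b) * μ) * ((t : ℝ) - D (b + 1)) := by
            refine hc.trans_lt (h6.trans_eq ?_)
            ring
          have h8 := lt_of_mul_lt_mul_right h7 (by linarith)
          linarith
      · exact .inl ⟨a, h1, by omega, h3⟩
    · exact .inr h

theorem BackInv.push (h : BackInv m Y B L t f e D)
    (hc : f < e - 1 → (Y t - Y (D (e - 1))) * ((D (e - 1) : ℝ) - D (e - 1 - 1)) <
      (Y (D (e - 1)) - Y (D (e - 1 - 1))) * ((t : ℝ) - D (e - 1))) :
    FrontInv m Y B L (t + 1) f (e + 1) (update D e t) where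
  pos := by omega
  attained := h.attained
  le := h.le
  nonempty := by have := h.nonempty; omega
  vertex_lt a ha ha' := by
    by_cases hae : a = e
    · subst hae; simp
    · rw [Function.update_of_ne hae]
      exact (h.vertex_lt a ha (by omega)).trans (Nat.lt_succ_self t)
  sorted a ha ha' := by
    rw [Function.update_of_ne (show a ≠ e by omega)]
    by_cases hae : a + 1 = e
    · subst hae
      rw [Function.update_self]
      exact h.vertex_lt a ha (by omega)
    · rw [Function.update_of_ne hae]
      exact h.sorted a ha (by omega)
  concave a ha ha' := by
    rw [Function.update_of_ne (show a ≠ e by omega),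
      Function.update_of_ne (show a + 1 ≠ e by omega)]
    by_cases hae : a + 2 = e
    · subst hae
      rw [Function.update_self]
      exact (hc (by omega)).le
    · rw [Function.update_of_ne hae]
      exact h.concave a ha (by omega)
  cover s hs μ hμ := by
    rcases h.cover s hs μ hμ with ⟨a, h1, h2, h3⟩ | h'
    · exact ⟨a, h1, by omega, by rwa [Function.update_of_ne (by omega)]⟩
    · exact ⟨e, h.nonempty.le, by omega, by rwa [Function.update_self]⟩

theorem FrontInv.isMinSlope (h : FrontInv m Y B L m f e D) : IsMinSlope m Y B L :=
  ⟨h.attained, h.le⟩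

end

/-- The greedy positions, shifted by one: `greedy Y L (t + 1)` is the leftmost point not left of
`Y t` that lies at least `L` to the right of the greedy position before it. -/
noncomputable def greedy (Y : ℕ → ℝ) (L : ℝ) : ℕ → ℝ
  | 0 => Y 0 - L
  | t + 1 => max (greedy Y L t + L) (Y t)

theorem le_greedy (Y : ℕ → ℝ) (L : ℝ) (t : ℕ) : Y t ≤ greedy Y L (t + 1) := le_max_right _ _

theorem greedy_add_le (Y : ℕ → ℝ) (L : ℝ) (t : ℕ) : greedy Y L t + L ≤ greedy Y L (t + 1) :=
  le_max_left _ _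

theorem exists_greedy_eq (Y : ℕ → ℝ) (L : ℝ) (t : ℕ) :
    ∃ s ≤ t, greedy Y L (t + 1) = Y s + ((t : ℝ) - s) * L := by
  induction t with
  | zero => exact ⟨0, le_rfl, by simp [greedy]⟩
  | succ t ih =>
    obtain ⟨s, hs, he⟩ := ih
    rcases le_total (greedy Y L (t + 1) + L) (Y (t + 1)) with h | h
    · exact ⟨t + 1, le_rfl, by rw [greedy, max_eq_right h]; simp⟩
    · refine ⟨s, by omega, ?_⟩
      rw [greedy, max_eq_left h, he]
      push_cast
      ring

theorem IsMinSlope.greedy_le {m : ℕ} {Y : ℕ → ℝ} {B L : ℝ} (h : IsMinSlope m Y B L) {t : ℕ}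
    (ht : t < m) : greedy Y L (t + 1) ≤ Y t + 1 := by
  obtain ⟨s, hs, he⟩ := exists_greedy_eq Y L t
  rcases hs.lt_or_eq with hs | rfl
  · have := h.le s t hs ht
    linarith
  · rw [he]
    simp

end LMCSI

/-! ### Optimality of the greedy realization -/

namespace LMCSI

variable {n k : ℕ} {x r : Fin n → ℝ} {color : Fin n → Fin k} {q : ℝ}

theorem add_one_lt_of_disjoint (hx : Monotone x)
    (hd : Pairwise fun i j => Disjoint (unitSegment x i) (unitSegment x j)) {i j : Fin n}
    (hij : i < j) : x i + 1 < x j := by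
  by_contra h
  push Not at h
  exact Set.disjoint_left.1 (hd hij.ne) (show x j ∈ unitSegment x i from ⟨hx hij.le, h⟩)
    ⟨le_rfl, by linarith⟩

theorem IsRealization.monotone (hr : IsRealization x r)
    (hsep : ∀ i j, i < j → x i + 1 < x j) : Monotone r := by
  intro i j hij
  rcases hij.lt_or_eq with h | rfl
  · linarith [hsep i j h, (hr i).2, (hr j).1]
  · exact le_rfl

/-- Every color-spanning interval contains one that is bounded by two representatives. -/
theorem IsColorSpanning.exists_shrink {a b : ℝ} (hk : 0 < k) (h : IsColorSpanning color r a b) :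
    ∃ i j, a ≤ r i ∧ r j ≤ b ∧ IsColorSpanning color r (r i) (r j) := by
  classical
  let S : Finset (Fin n) := Finset.univ.filter fun i => r i ∈ Set.Icc a b
  obtain ⟨i₀, -, hi₀⟩ := h.2 ⟨0, hk⟩
  have hS : S.Nonempty := ⟨i₀, by simpa [S] using hi₀⟩
  obtain ⟨i, hi, himin⟩ := S.exists_min_image r hS
  obtain ⟨j, hj, hjmax⟩ := S.exists_max_image r hS
  have hi' : r i ∈ Set.Icc a b := by simpa [S] using hi
  have hj' : r j ∈ Set.Icc a b := by simpa [S] using hj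
  refine ⟨i, j, hi'.1, hj'.2, himin j hj, fun c => ?_⟩
  obtain ⟨v, hv, hvab⟩ := h.2 c
  have hvS : v ∈ S := by simpa [S] using hvab
  exact ⟨v, hv, himin v hvS, hjmax v hvS⟩

theorem exists_isMCSILength (hn : 0 < n) (hk : 0 < k) (hc : Function.Surjective color)
    (r : Fin n → ℝ) : ∃ q, IsMCSILength color r q := by
  classical
  let S : Finset (Fin n × Fin n) :=
    Finset.univ.filter fun p => IsColorSpanning color r (r p.1) (r p.2)
  have : Nonempty (Fin n) := ⟨⟨0, hn⟩⟩
  have hfull : ∃ a b, IsColorSpanning color r a b := by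
    obtain ⟨i, hi⟩ := Finite.exists_min r
    obtain ⟨j, hj⟩ := Finite.exists_max r
    refine ⟨r i, r j, hi j, fun c => ?_⟩
    obtain ⟨v, hv⟩ := hc c
    exact ⟨v, hv, hi v, hj v⟩
  obtain ⟨a, b, hab⟩ := hfull
  obtain ⟨i₀, j₀, -, -, h₀⟩ := hab.exists_shrink hk
  obtain ⟨⟨i, j⟩, hij, hmin⟩ := S.exists_min_image (fun p => r p.2 - r p.1)
    ⟨(i₀, j₀), by simpa [S] using h₀⟩
  have hij' : IsColorSpanning color r (r i) (r j) := by simpa [S] using hij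
  refine ⟨r j - r i, ⟨_, _, hij', rfl⟩, ?_⟩
  rintro l ⟨a, b, hab, rfl⟩
  obtain ⟨i', j', hi', hj', h'⟩ := hab.exists_shrink hk
  have := hmin (i', j') (by simpa [S] using h')
  simp only at this
  linarith

/-- Numbering segments and colors by natural numbers does not change the spanning windows. -/
theorem IsMCSILength.le_sub {colorN : ℕ → ℕ} (hcol : ∀ i : Fin n, colorN i = color i)
    (hq : IsMCSILength color r q) (hr : Monotone r) {a b : ℕ} (hab : a ≤ b) (hb : b < n)
    (hs : Spans k colorN a b) : q ≤ r ⟨b, hb⟩ - r ⟨a, hab.trans_lt hb⟩ := by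
  refine hq.2 ⟨_, _, ⟨hr hab, fun c => ?_⟩, rfl⟩
  obtain ⟨i, h1, h2, h3⟩ := hs c c.2
  exact ⟨⟨i, h2.trans_lt hb⟩, Fin.ext ((hcol _).symm.trans h3), hr h1, hr h2⟩

theorem spans_all {colorN : ℕ → ℕ} (hcol : ∀ i : Fin n, colorN i = color i)
    (hc : Function.Surjective color) : Spans k colorN 0 (n - 1) := by
  intro c hck
  obtain ⟨i, hi⟩ := hc ⟨c, hck⟩
  exact ⟨i, Nat.zero_le _, by omega, by rw [hcol, hi]⟩

/-- A color-spanning interval is at least as long as the shortest distance along a link. -/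
theorem IsColorSpanning.le_of_links {colorN nxt hp : ℕ → ℕ} {L a b : ℝ}
    (hcol : ∀ i : Fin n, colorN i = color i)
    (ht : IsLinkTable n k colorN nxt hp) (hk : 2 ≤ k) (hr : Monotone r)
    (hL : ∀ (i : ℕ) (hi : nxt i < n) (hi' : i < n), nxt i ≠ 0 → L ≤ r ⟨nxt i, hi⟩ - r ⟨i, hi'⟩)
    (h : IsColorSpanning color r a b) : L ≤ b - a := by
  classical
  let S : Finset (Fin n) := Finset.univ.filter fun i => r i ∈ Set.Icc a b
  obtain ⟨i₀, -, hi₀⟩ := h.2 ⟨0, by omega⟩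
  have hS : S.Nonempty := ⟨i₀, by simpa [S] using hi₀⟩
  have hi : r (S.min' hS) ∈ Set.Icc a b := by simpa [S] using S.min'_mem hS
  have hj : r (S.max' hS) ∈ Set.Icc a b := by simpa [S] using S.max'_mem hS
  have hs : Spans k colorN (S.min' hS) (S.max' hS) := by
    intro c hc
    obtain ⟨v, hv, hvab⟩ := h.2 ⟨c, hc⟩
    have hvS : v ∈ S := by simpa [S] using hvab
    exact ⟨v, S.min'_le v hvS, S.le_max' v hvS, by rw [hcol, hv]⟩
  obtain ⟨v, h1, h2, h3, h4⟩ := ht.complete hk _ _ (S.max' hS).2 hs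
  have hv : nxt v < n := h4.trans_lt (S.max' hS).2
  have hv' : v < n := h2.trans (S.max' hS).2
  have h5 := hL v hv hv' h3
  have h6 : r (S.min' hS) ≤ r ⟨v, hv'⟩ := hr h1
  have h7 : r ⟨nxt v, hv⟩ ≤ r (S.max' hS) := hr h4
  linarith [hi.1, hj.2]

/-- The greedy positions, carried back from the virtual positions to the segments, solve the
problem.  Their gaps along links are at least `L`; and no realization has a larger MCSI, since its
offsets within the segments, which lie in `[0, 1]`, give virtual positions whose gaps are at least
its MCSI length, on a stretch of the list where the average gap is at most `L`. -/
theorem isSolution_of_greedy {xN out Y : ℕ → ℝ} {colorN nxt hp p : ℕ → ℕ} {B L : ℝ} {m : ℕ}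
    (hn : 0 < n) (hx : Monotone x)
    (hd : Pairwise fun i j => Disjoint (unitSegment x i) (unitSegment x j))
    (hc : Function.Surjective color)
    (hxN : ∀ i : Fin n, xN i = x i) (hcol : ∀ i : Fin n, colorN i = color i)
    (ht : IsLinkTable n k colorN nxt hp) (hB : B = xN (n - 1) - xN 0 + 2)
    (hl : IsPathList n xN nxt B m p Y) (hL : IsMinSlope m Y B L)
    (hout : ∀ t < m, out (p t) = xN (p t) + greedy Y L (t + 1) - Y t) :
    IsSolution x color fun i => out i := by
  have hk : 0 < k := (Nat.zero_le _).trans_lt (color ⟨0, hn⟩).2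
  have hsep : ∀ i j, i < j → x i + 1 < x j := fun i j => add_one_lt_of_disjoint hx hd
  have hreal : IsRealization x fun i => out i := by
    intro i
    obtain ⟨t, htm, hti⟩ := hl.surj i i.2
    have h1 := hout t htm
    have h2 := le_greedy Y L t
    have h3 := hL.greedy_le htm
    rw [hti, hxN] at h1
    constructor <;> linarith
  obtain ⟨l, hl'⟩ := exists_isMCSILength hn hk hc fun i : Fin n => out i
  refine ⟨hreal, l, hl', fun r' q' hr' hq' => ?_⟩
  obtain ⟨⟨a, b, hab, rfl⟩, -⟩ := hl'
  rcases Nat.lt_or_ge 1 k with hk2 | hk1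
  swap
  · -- With a single color, a single representative is color-spanning.
    have : q' ≤ r' ⟨0, hn⟩ - r' ⟨0, hn⟩ := hq'.2 ⟨_, _, ⟨le_rfl, fun c =>
      ⟨⟨0, hn⟩, Fin.ext (by omega), le_rfl, le_rfl⟩⟩, rfl⟩
    linarith [hab.1]
  have hmono' := hr'.monotone hsep
  refine le_trans ?_ (hab.le_of_links hcol ht hk2 (hreal.monotone hsep) (L := L) ?_)
  · -- An arbitrary realization, seen in the virtual positions, has gaps of at least `q'`.
    have hqB : q' + 1 ≤ B := by
      have h1 := hq'.le_sub hcol hmono' (Nat.zero_le _) (Nat.sub_lt hn Nat.one_pos)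
        (spans_all hcol hc)
      have h2 := (hr' ⟨n - 1, Nat.sub_lt hn Nat.one_pos⟩).2
      have h3 := (hr' ⟨0, hn⟩).1
      have h4 := hxN ⟨n - 1, Nat.sub_lt hn Nat.one_pos⟩
      have h5 := hxN ⟨0, hn⟩
      simp only at h4 h5
      linarith
    rcases hL.attained with hLB | ⟨s, t', hst, htm, he⟩
    · linarith
    let u : ℕ → ℝ := fun t => if h : p t < n then r' ⟨p t, h⟩ - x ⟨p t, h⟩ else 0
    have hu : ∀ t < m, 0 ≤ u t ∧ u t ≤ 1 := by
      intro t htm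
      have h := hr' ⟨p t, hl.lt t htm⟩
      simp only [u, hl.lt t htm, dif_pos]
      constructor <;> linarith [h.1, h.2]
    have hgap : ∀ t, t + 1 < m → q' ≤ (Y (t + 1) + u (t + 1)) - (Y t + u t) := by
      intro t ht1
      have htn := hl.lt t (by omega)
      have htn1 := hl.lt (t + 1) ht1
      rcases hl.gap t ht1 with ⟨h1, h2, h3⟩ | h3
      · obtain ⟨g1, g2, g3⟩ := ht.link _ htn h2
        rw [h1] at g1 g3
        have h4 := hq'.le_sub hcol hmono' g1.le htn1 g3
        have h5 := hxN ⟨p t, htn⟩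
        have h6 := hxN ⟨p (t + 1), htn1⟩
        simp only at h5 h6
        simp only [u, htn, htn1, dif_pos]
        linarith
      · linarith [(hu t (by omega)).2, (hu (t + 1) ht1).1]
    have hsum : ∀ t', s ≤ t' → t' < m →
        ((t' : ℝ) - s) * q' ≤ (Y t' + u t') - (Y s + u s) := by
      intro t' hs
      induction t', hs using Nat.le_induction with
      | base => intro _; simp
      | succ t' hs ih =>
        intro ht1
        have := ih (by omega)
        have := hgap t' ht1
        push_cast
        linarith
    have h1 := hsum t' hst.le htm
    have h2 : ((t' : ℝ) - s) * q' ≤ ((t' : ℝ) - s) * L := by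
      linarith [(hu t' htm).2, (hu s (hst.trans htm)).1]
    have h3 : (s : ℝ) < t' := by exact_mod_cast hst
    exact le_of_mul_le_mul_left h2 (by linarith)
  · intro i hi hi' hne
    obtain ⟨t, htm, rfl⟩ := hl.surj i hi'
    obtain ⟨h1, h2, h3⟩ := hl.linked t htm hne
    have h4 := hout t htm
    have h5 := hout (t + 1) h1
    have h6 := greedy_add_le Y L (t + 1)
    rw [h2] at h3 h5
    simp only
    linarith

end LMCSI

/-! ### The program -/

namespace RealRAM

/-- The program that executes a list of instructions. -/
def block : List Instr → Program
  | [] => .skip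
  | c :: l => .seq (.instr c) (block l)

@[simp] theorem wp_block_nil (Q : State → Prop) (s : State) :
    (block []).wp Q s ↔ Q s := Iff.rfl

theorem wp_block_cons {c : Instr} {l : List Instr} {Q : State → Prop} {s s' : State}
    (h : c.step s = some s') : (block (c :: l)).wp Q s ↔ (block l).wp Q s' := by
  simp [block, Program.wp, h]

section
variable (l : List Instr) (Q : State → Prop) (s : State) (a i m u v w : ℕ) (q : ℚ)

@[simp] theorem wp_natConst : (block (.natConst v m :: l)).wp Q s ↔
    (block l).wp Q (s.setNat v m) := wp_block_cons rfl
@[simp] theorem wp_natCopy : (block (.natCopy v w :: l)).wp Q s ↔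
    (block l).wp Q (s.setNat v (s.nat w)) := wp_block_cons rfl
@[simp] theorem wp_natSucc : (block (.natSucc v :: l)).wp Q s ↔
    (block l).wp Q (s.setNat v (s.nat v + 1)) := wp_block_cons rfl
@[simp] theorem wp_natPred : (block (.natPred v :: l)).wp Q s ↔
    (block l).wp Q (s.setNat v (s.nat v - 1)) := wp_block_cons rfl
@[simp] theorem wp_natLoad : (block (.natLoad v a i :: l)).wp Q s ↔
    (block l).wp Q (s.setNat v (s.natArr a (s.nat i))) := wp_block_cons rfl
@[simp] theorem wp_natStore : (block (.natStore a i v :: l)).wp Q s ↔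
    (block l).wp Q (s.setNatArr a (s.nat i) (s.nat v)) := wp_block_cons rfl
@[simp] theorem wp_realConst : (block (.realConst v q :: l)).wp Q s ↔
    (block l).wp Q (s.setReal v (q : ℝ)) := wp_block_cons rfl
@[simp] theorem wp_realCopy : (block (.realCopy v w :: l)).wp Q s ↔
    (block l).wp Q (s.setReal v (s.real w)) := wp_block_cons rfl
@[simp] theorem wp_realCast : (block (.realCast v w :: l)).wp Q s ↔
    (block l).wp Q (s.setReal v (s.nat w : ℝ)) := wp_block_cons rfl
@[simp] theorem wp_realAdd : (block (.realAdd u v w :: l)).wp Q s ↔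
    (block l).wp Q (s.setReal u (s.real v + s.real w)) := wp_block_cons rfl
@[simp] theorem wp_realSub : (block (.realSub u v w :: l)).wp Q s ↔
    (block l).wp Q (s.setReal u (s.real v - s.real w)) := wp_block_cons rfl
@[simp] theorem wp_realMul : (block (.realMul u v w :: l)).wp Q s ↔
    (block l).wp Q (s.setReal u (s.real v * s.real w)) := wp_block_cons rfl
@[simp] theorem wp_realLoad : (block (.realLoad v a i :: l)).wp Q s ↔
    (block l).wp Q (s.setReal v (s.realArr a (s.nat i))) := wp_block_cons rfl
@[simp] theorem wp_realStore : (block (.realStore a i v :: l)).wp Q s ↔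
    (block l).wp Q (s.setRealArr a (s.nat i) (s.real v)) := wp_block_cons rfl
@[simp] theorem wp_realDiv : (block (.realDiv u v w :: l)).wp Q s ↔
    s.real w ≠ 0 ∧ (block l).wp Q (s.setReal u (s.real v / s.real w)) := by
  by_cases h : s.real w = 0 <;> simp [block, Program.wp, Instr.step, h]

end

/-- A loop with its initialization, when the number of rounds is linear in `n`. -/
theorem Runs.block_loop {A P : Program} {b : Test} {Q : State → Prop} {s : State} {n M : ℕ}
    (hn : 0 < n) (I : State → Prop) (μ : State → ℕ)
    (init : A.wp (fun s' => I s' ∧ μ s' + 1 ≤ M * n) s)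
    (step : ∀ s, I s → b.Holds s → P.wp (fun s' => I s' ∧ μ s' < μ s) s)
    (final : ∀ s, I s → ¬ b.Holds s → Q s) :
    Runs (.seq A (.loop b P)) s ((A.blockCost + M * (b.cost + P.blockCost)) * n) Q := by
  refine ((Runs.of_wp init).seq fun s' h => ((Runs.loop I μ step h.1).mono
    (Nat.mul_le_mul_right _ h.2) fun s h => final s h.1 h.2)).mono ?_ fun _ => id
  have := Nat.le_mul_of_pos_right A.blockCost hn
  linarith [show (A.blockCost + M * (b.cost + P.blockCost)) * n =
    A.blockCost * n + M * n * (b.cost + P.blockCost) by ring]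

end RealRAM

namespace LMCSI

open RealRAM

/-! Integer registers, real registers, integer arrays and real arrays are numbered separately, so
that for instance `Reg.size` and `Reg.B` do not clash. -/

namespace Reg

/-! Integer registers: the input `size`, `colors`; the constants `zero`, `one`; the phase `mode` of
a flattened loop; `j`, `l`, `d` of `ScanInv`; `p`, `c`, `m`, `u` of `ListInv`; `t`, `f`, `e` of
`HullInv`; the auxiliary registers `v₁`, …, `v₄`. -/

abbrev size : ℕ := 0
abbrev colors : ℕ := 1
abbrev zero : ℕ := 2
abbrev one : ℕ := 3
abbrev mode : ℕ := 4
abbrev j : ℕ := 5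
abbrev l : ℕ := 6
abbrev d : ℕ := 7
abbrev p : ℕ := 8
abbrev c : ℕ := 9
abbrev m : ℕ := 10
abbrev u : ℕ := 11
abbrev t : ℕ := 12
abbrev f : ℕ := 13
abbrev e : ℕ := 14
abbrev v₁ : ℕ := 15
abbrev v₂ : ℕ := 16
abbrev v₃ : ℕ := 17
abbrev v₄ : ℕ := 18

/-! Real registers: the gap `B` between paths, the minimum slope `L`, the last virtual position `y`,
the last greedy position `ρ`, and the auxiliary registers `w₁`, …, `w₆`. -/

abbrev B : ℕ := 0
abbrev L : ℕ := 1
abbrev y : ℕ := 2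
abbrev ρ : ℕ := 3
abbrev w₁ : ℕ := 4
abbrev w₂ : ℕ := 5
abbrev w₃ : ℕ := 6
abbrev w₄ : ℕ := 7
abbrev w₅ : ℕ := 8
abbrev w₆ : ℕ := 9

end Reg

namespace Arr

/-! Integer arrays: the input `color`; `last`, `nxt`, `hp` of `ScanInv`; the list `list` of
`IsPathList`; the chain `D` of `HullInv`. -/

abbrev color : ℕ := 0
abbrev last : ℕ := 1
abbrev nxt : ℕ := 2
abbrev hp : ℕ := 3
abbrev list : ℕ := 4
abbrev D : ℕ := 5

/-! Real arrays: the input `x`, the output `out`, and the virtual positions `Y`. -/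

abbrev x : ℕ := 0
abbrev out : ℕ := 1
abbrev Y : ℕ := 2

end Arr

/-- Initialization of the scan. -/
def scanInit : Program := block
  [.natConst Reg.zero 0, .natConst Reg.one 1, .natConst Reg.mode 0, .natConst Reg.j 0,
    .natConst Reg.l 0, .natConst Reg.d 0]

/-- One step of the scan for links: in mode 0, segment `j` is read; in mode 1, the left pointer `l`
is advanced, or the window from `l` to `j` is recorded if it is a new link. -/
def scanBody : Program :=
  .ite (.natEq Reg.mode Reg.zero)
    (.seq (block [.natLoad Reg.v₁ Arr.color Reg.j, .natLoad Reg.v₂ Arr.last Reg.v₁,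
        .natLoad Reg.v₃ Arr.color Reg.v₂])
      (.seq (.ite (.conj (.natLt Reg.v₂ Reg.j) (.natEq Reg.v₃ Reg.v₁))
          .skip (block [.natSucc Reg.d]))
        (block [.natStore Arr.last Reg.v₁ Reg.j, .natStore Arr.nxt Reg.j Reg.zero,
          .natStore Arr.hp Reg.j Reg.zero, .natCopy Reg.mode Reg.one])))
    (.seq (block [.natLoad Reg.v₁ Arr.color Reg.l, .natLoad Reg.v₂ Arr.last Reg.v₁])
      (.ite (.natEq Reg.v₂ Reg.l)
        (.seq (block [.natLoad Reg.v₃ Arr.nxt Reg.l])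
          (.seq (.ite (.conj (.natEq Reg.d Reg.colors) (.conj (.natEq Reg.v₃ Reg.zero)
              (.natLt Reg.l Reg.j)))
              (block [.natStore Arr.nxt Reg.l Reg.j, .natStore Arr.hp Reg.j Reg.one]) .skip)
            (block [.natSucc Reg.j, .natCopy Reg.mode Reg.zero])))
        (block [.natSucc Reg.l])))

/-- Initialization of the concatenation.  The gap between paths is by one larger than the longest
interval between two representatives can be. -/
def listInit : Program := block
  [.natCopy Reg.v₁ Reg.size, .natPred Reg.v₁, .realLoad Reg.w₁ Arr.x Reg.v₁,
    .realLoad Reg.w₂ Arr.x Reg.zero, .realSub Reg.w₁ Reg.w₁ Reg.w₂, .realConst Reg.w₂ 2,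
    .realAdd Reg.B Reg.w₁ Reg.w₂, .natConst Reg.p 0, .natConst Reg.c 0, .natConst Reg.m 0,
    .realConst Reg.y 0]

/-- One step of the concatenation: the next segment of the current path is listed, or else `p` is
listed if it starts a path. -/
def listBody : Program :=
  .ite (.natEq Reg.c Reg.zero)
    (.seq (block [.natLoad Reg.v₁ Arr.hp Reg.p])
      (.seq (.ite (.natEq Reg.v₁ Reg.zero)
          (block [.realAdd Reg.y Reg.y Reg.B, .natStore Arr.list Reg.m Reg.p,
            .realStore Arr.Y Reg.m Reg.y, .natSucc Reg.m, .natCopy Reg.u Reg.p,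
            .natLoad Reg.c Arr.nxt Reg.p])
          .skip)
        (block [.natSucc Reg.p])))
    (block [.realLoad Reg.w₁ Arr.x Reg.c, .realLoad Reg.w₂ Arr.x Reg.u,
      .realSub Reg.w₁ Reg.w₁ Reg.w₂, .realAdd Reg.y Reg.y Reg.w₁,
      .natStore Arr.list Reg.m Reg.c, .realStore Arr.Y Reg.m Reg.y, .natSucc Reg.m,
      .natCopy Reg.u Reg.c, .natLoad Reg.c Arr.nxt Reg.c])

/-- Initialization of the computation of the minimum slope. -/
def hullInit : Program := block
  [.realCopy Reg.L Reg.B, .natConst Reg.t 1, .natConst Reg.f 0, .natConst Reg.e 1,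
    .natConst Reg.mode 0, .natStore Arr.D Reg.zero Reg.zero]

/-- One step of the computation of the minimum slope `L`: in mode 0, `L` is lowered to the slope
between the front of the chain and `t`, and the front is removed if it is not needed any more; in
mode 1, the back of the chain is removed, or `t` is appended. -/
def hullBody : Program :=
  .ite (.natEq Reg.mode Reg.zero)
    (.seq (block [.natLoad Reg.v₁ Arr.D Reg.f, .realLoad Reg.w₁ Arr.Y Reg.v₁,
        .realLoad Reg.w₂ Arr.Y Reg.t, .realConst Reg.w₃ 1, .realAdd Reg.w₂ Reg.w₂ Reg.w₃,
        .realSub Reg.w₂ Reg.w₂ Reg.w₁, .realCast Reg.w₃ Reg.t, .realCast Reg.w₄ Reg.v₁,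
        .realSub Reg.w₃ Reg.w₃ Reg.w₄, .realDiv Reg.w₂ Reg.w₂ Reg.w₃])
      (.seq (.ite (.realLt Reg.w₂ Reg.L) (block [.realCopy Reg.L Reg.w₂]) .skip)
        (.seq (block [.natCopy Reg.v₂ Reg.f, .natSucc Reg.v₂, .natLoad Reg.v₃ Arr.D Reg.v₂,
            .realLoad Reg.w₂ Arr.Y Reg.v₃, .realSub Reg.w₂ Reg.w₂ Reg.w₁,
            .realCast Reg.w₃ Reg.v₃, .realSub Reg.w₃ Reg.w₃ Reg.w₄,
            .realMul Reg.w₃ Reg.w₃ Reg.L])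
          (.ite (.conj (.natLt Reg.v₂ Reg.e) (.neg (.realLt Reg.w₂ Reg.w₃)))
            (block [.natSucc Reg.f]) (block [.natCopy Reg.mode Reg.one])))))
    (.seq (block [.natCopy Reg.v₁ Reg.e, .natPred Reg.v₁, .natLoad Reg.v₂ Arr.D Reg.v₁,
        .natCopy Reg.v₃ Reg.v₁, .natPred Reg.v₃, .natLoad Reg.v₄ Arr.D Reg.v₃,
        .realLoad Reg.w₁ Arr.Y Reg.v₄, .realLoad Reg.w₂ Arr.Y Reg.v₂, .realLoad Reg.w₃ Arr.Y Reg.t,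
        .realSub Reg.w₁ Reg.w₂ Reg.w₁, .realSub Reg.w₃ Reg.w₃ Reg.w₂,
        .realCast Reg.w₄ Reg.v₄, .realCast Reg.w₅ Reg.v₂, .realCast Reg.w₆ Reg.t,
        .realSub Reg.w₄ Reg.w₅ Reg.w₄, .realSub Reg.w₆ Reg.w₆ Reg.w₅,
        .realMul Reg.w₁ Reg.w₁ Reg.w₆, .realMul Reg.w₃ Reg.w₃ Reg.w₄])
      (.ite (.conj (.natLt Reg.f Reg.v₁) (.neg (.realLt Reg.w₃ Reg.w₁)))
        (block [.natCopy Reg.e Reg.v₁])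
        (block [.natStore Arr.D Reg.e Reg.t, .natSucc Reg.e, .natSucc Reg.t,
          .natCopy Reg.mode Reg.zero])))

/-- Initialization of the greedy placement. -/
def placeInit : Program := block
  [.natConst Reg.t 0, .realLoad Reg.ρ Arr.Y Reg.zero, .realSub Reg.ρ Reg.ρ Reg.L]

/-- One step of the greedy placement. -/
def placeBody : Program :=
  .seq (block [.realAdd Reg.ρ Reg.ρ Reg.L, .realLoad Reg.w₁ Arr.Y Reg.t])
    (.seq (.ite (.realLt Reg.ρ Reg.w₁) (block [.realCopy Reg.ρ Reg.w₁]) .skip)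
      (block [.natLoad Reg.v₁ Arr.list Reg.t, .realLoad Reg.w₂ Arr.x Reg.v₁,
        .realAdd Reg.w₂ Reg.w₂ Reg.ρ, .realSub Reg.w₂ Reg.w₂ Reg.w₁,
        .realStore Arr.out Reg.v₁ Reg.w₂, .natSucc Reg.t]))

/-- The program solving the L-MCSI problem for disjoint segments. -/
def solver : Program :=
  .seq (.seq scanInit (.loop (.natLt Reg.j Reg.size) scanBody))
    (.seq (.seq listInit (.loop (.natLt Reg.p Reg.size) listBody))
      (.seq (.seq hullInit (.loop (.natLt Reg.t Reg.m) hullBody))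
        (.seq placeInit (.loop (.natLt Reg.t Reg.m) placeBody))))

/-! ### Correctness and running time of the program -/

/-- The part of the memory that the program does not change after its first instructions. -/
def Env (n k : ℕ) (x : ℕ → ℝ) (color : ℕ → ℕ) (s : State) : Prop :=
  s.nat Reg.size = n ∧ s.nat Reg.colors = k ∧ s.nat Reg.zero = 0 ∧ s.nat Reg.one = 1 ∧
    s.realArr Arr.x = x ∧ s.natArr Arr.color = color

section
variable {n k : ℕ} {x : ℕ → ℝ} {color : ℕ → ℕ}

/-- The invariant of the scan, as a property of the memory. -/
def ScanState (n k : ℕ) (x : ℕ → ℝ) (color : ℕ → ℕ) (s : State) : Prop :=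
  Env n k x color s ∧ s.nat Reg.j ≤ n ∧
    ((s.nat Reg.mode = 0 ∧ ScanInv k color (s.nat Reg.j) (s.nat Reg.j) (s.nat Reg.l) (s.nat Reg.d)
        (s.natArr Arr.last) (s.natArr Arr.nxt) (s.natArr Arr.hp)) ∨
      (s.nat Reg.mode = 1 ∧ s.nat Reg.j < n ∧
        ScanInv k color (s.nat Reg.j + 1) (s.nat Reg.j) (s.nat Reg.l) (s.nat Reg.d)
          (s.natArr Arr.last) (s.natArr Arr.nxt) (s.natArr Arr.hp)))

theorem wp_scanBody (hcol : ∀ i < n, color i < k) (s : State) (h : ScanState n k x color s)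
    (hj : (Test.natLt Reg.j Reg.size).Holds s) :
    scanBody.wp (fun s' => ScanState n k x color s' ∧
      3 * (n - s'.nat Reg.j) + (n - s'.nat Reg.l) + (1 - s'.nat Reg.mode) <
      3 * (n - s.nat Reg.j) + (n - s.nat Reg.l) + (1 - s.nat Reg.mode)) s := by
  obtain ⟨⟨h1, h2, h3, h4, h5, h6⟩, hjn, h⟩ := h
  simp only [Test.Holds, h1] at hj
  rcases h with ⟨hm, h⟩ | ⟨hm, -, h⟩
  · simp [scanBody, Program.wp, Test.Holds, hm, h3]
    simp [ScanState, Env, h1, h2, h3, h4, h5, h6, hj, hj.le]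
    constructor
    · intro ha hb
      exact h.read (by rw [if_pos ⟨ha, hb⟩])
    · intro ha
      exact h.read (by rw [if_neg (fun hc => ha hc.1 hc.2)])
  · have hcol' : ∀ i ≤ s.nat Reg.j, color i < k := fun i hi => hcol i (hi.trans_lt hj)
    have hlj := h.le
    simp [scanBody, Program.wp, Test.Holds, hm, h3]
    simp [ScanState, Env, h1, h2, h3, h4, h5, h6, hj, hm]
    refine ⟨fun hl => ⟨fun ha hb hc => ⟨h.record hcol' hl ha hb hc, ?_⟩,
      fun ha => ⟨h.skip hcol' hl ?_, ?_⟩⟩, fun hl => ⟨⟨hj.le, h.advance hl⟩, ?_⟩⟩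
    · omega
    · rintro ⟨h1, h2, h3⟩
      exact absurd (ha h1 h2) (by omega)
    · omega
    · omega

/-- What is known after the scan. -/
def LinkState (n k : ℕ) (x : ℕ → ℝ) (color nxt hp : ℕ → ℕ) (s : State) : Prop :=
  Env n k x color s ∧ s.natArr Arr.nxt = nxt ∧ s.natArr Arr.hp = hp

/-- The invariant of the concatenation, as a property of the memory. -/
def ListState (n k : ℕ) (x : ℕ → ℝ) (color nxt hp : ℕ → ℕ) (B : ℝ) (s : State) : Prop :=
  LinkState n k x color nxt hp s ∧ s.real Reg.B = B ∧
    ListInv n x nxt hp B (s.nat Reg.p) (s.nat Reg.c) (s.nat Reg.m) (s.nat Reg.u) (s.real Reg.y)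
      (s.natArr Arr.list) (s.realArr Arr.Y)

theorem wp_listBody {nxt hp : ℕ → ℕ} {B : ℝ} (ht : IsLinkTable n k color nxt hp) (s : State)
    (h : ListState n k x color nxt hp B s) (hp0 : (Test.natLt Reg.p Reg.size).Holds s) :
    listBody.wp (fun s' => ListState n k x color nxt hp B s' ∧
      (n - s'.nat Reg.p) + (n - s'.nat Reg.m) < (n - s.nat Reg.p) + (n - s.nat Reg.m)) s := by
  obtain ⟨⟨⟨h1, h2, h3, h4, h5, h6⟩, h7, h8⟩, hB, h⟩ := h
  simp only [Test.Holds, h1] at hp0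
  simp [listBody, Program.wp, Test.Holds, h3]
  simp [ListState, LinkState, Env, h1, h2, h3, h4, h5, h6, h7, h8, hB]
  refine ⟨fun hc => ⟨fun hr => ?_, fun hr => ⟨h.next hp0 hc hr, by omega⟩⟩, fun hc => ?_⟩
  · have h' := h.begin ht hp0 hc hr
    exact ⟨h', by have := h'.length_le; omega⟩
  · have h' := h.follow ht hc
    exact ⟨h', by have := h'.length_le; omega⟩

/-- What is known after the concatenation. -/
def PathState (n k : ℕ) (x : ℕ → ℝ) (color : ℕ → ℕ) (m : ℕ) (q : ℕ → ℕ) (Y : ℕ → ℝ) (s : State) :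
    Prop :=
  Env n k x color s ∧ s.nat Reg.m = m ∧ s.natArr Arr.list = q ∧ s.realArr Arr.Y = Y

/-- The invariant of the computation of the minimum slope, as a property of the memory. -/
def HullState (n k : ℕ) (x : ℕ → ℝ) (color : ℕ → ℕ) (m : ℕ) (q : ℕ → ℕ) (Y : ℕ → ℝ) (B : ℝ)
    (s : State) : Prop :=
  PathState n k x color m q Y s ∧ s.nat Reg.t ≤ m ∧
    ((s.nat Reg.mode = 0 ∧ FrontInv m Y B (s.real Reg.L) (s.nat Reg.t) (s.nat Reg.f) (s.nat Reg.e)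
        (s.natArr Arr.D)) ∨
      (s.nat Reg.mode = 1 ∧ s.nat Reg.t < m ∧
        BackInv m Y B (s.real Reg.L) (s.nat Reg.t) (s.nat Reg.f) (s.nat Reg.e) (s.natArr Arr.D)))

theorem wp_hullBody {m : ℕ} {q : ℕ → ℕ} {Y : ℕ → ℝ} {B : ℝ} (s : State)
    (h : HullState n k x color m q Y B s) (htm : (Test.natLt Reg.t Reg.m).Holds s) :
    hullBody.wp (fun s' => HullState n k x color m q Y B s' ∧
      3 * (m - s'.nat Reg.t) + (s'.nat Reg.e - s'.nat Reg.f) + (1 - s'.nat Reg.mode) <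
      3 * (m - s.nat Reg.t) + (s.nat Reg.e - s.nat Reg.f) + (1 - s.nat Reg.mode)) s := by
  obtain ⟨⟨⟨h1, h2, h3, h4, h5, h6⟩, h7, h8, h9⟩, -, h⟩ := h
  simp only [Test.Holds, h7] at htm
  rcases h with ⟨hm, h⟩ | ⟨hm, -, h⟩
  · have hfe := h.nonempty
    have hpos := h.sub_pos
    simp [hullBody, Program.wp, Test.Holds, hm, h3]
    simp [HullState, PathState, Env, h1, h2, h3, h4, h5, h6, h7, h8, h9, htm, htm.le, hm]
    refine ⟨hpos.ne', fun hL => ?_, fun hL => ⟨fun hf hc => ⟨h.popFront hf hc, by omega⟩,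
      fun hc => h.toBack ?_ hc⟩⟩
    · have h' := h.lower htm hL
      refine ⟨fun hf hc => ⟨h'.popFront hf hc, by omega⟩, fun hc => h'.toBack ?_ hc⟩
      rw [mul_div_cancel₀ _ hpos.ne']
    · rwa [le_div_iff₀ hpos, mul_comm] at hL
  · have hfe := h.nonempty
    simp [hullBody, Program.wp, Test.Holds, hm, h3]
    simp [HullState, PathState, Env, h1, h2, h3, h4, h5, h6, h7, h8, h9, htm, htm.le, hm]
    exact ⟨fun hf hc => ⟨h.popBack hf hc, by omega⟩, fun hc => ⟨h.push hc, by omega⟩⟩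

/-- The invariant of the placement, as a property of the memory. -/
def PlaceState (n k : ℕ) (x : ℕ → ℝ) (color : ℕ → ℕ) (m : ℕ) (q : ℕ → ℕ) (Y : ℕ → ℝ) (L : ℝ)
    (s : State) : Prop :=
  PathState n k x color m q Y s ∧ s.real Reg.L = L ∧ s.real Reg.ρ = greedy Y L (s.nat Reg.t) ∧
    s.nat Reg.t ≤ m ∧
    ∀ t < s.nat Reg.t, s.realArr Arr.out (q t) = x (q t) + greedy Y L (t + 1) - Y t

theorem wp_placeBody {m : ℕ} {q : ℕ → ℕ} {Y : ℕ → ℝ} {L : ℝ}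
    (hq : ∀ t < m, ∀ t' < m, q t = q t' → t = t') (s : State)
    (h : PlaceState n k x color m q Y L s) (htm : (Test.natLt Reg.t Reg.m).Holds s) :
    placeBody.wp (fun s' => PlaceState n k x color m q Y L s' ∧
      m - s'.nat Reg.t < m - s.nat Reg.t) s := by
  obtain ⟨⟨⟨h1, h2, h3, h4, h5, h6⟩, h7, h8, h9⟩, hL, hρ, -, h⟩ := h
  simp only [Test.Holds, h7] at htm
  simp [placeBody, Program.wp, Test.Holds]
  simp [PlaceState, PathState, Env, h1, h2, h3, h4, h5, h6, h7, h8, h9, hL, hρ,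
    Nat.succ_le_of_lt htm]
  have hout : ∀ z, z = x (q (s.nat Reg.t)) + greedy Y L (s.nat Reg.t + 1) - Y (s.nat Reg.t) →
      ∀ t ≤ s.nat Reg.t, Function.update (s.realArr Arr.out) (q (s.nat Reg.t)) z (q t) =
        x (q t) + greedy Y L (t + 1) - Y t := by
    intro z hz t ht
    rcases ht.lt_or_eq with ht | rfl
    · rw [Function.update_of_ne, h t ht]
      exact fun he => ht.ne (hq t (ht.trans htm) _ htm he)
    · rw [Function.update_self, hz]
  refine ⟨fun hlt => ⟨⟨?_, hout _ ?_⟩, by omega⟩, fun hle => ⟨⟨?_, hout _ ?_⟩, by omega⟩⟩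
  · rw [greedy, max_eq_right hlt.le]
  · rw [greedy, max_eq_right hlt.le]
    ring
  · rw [greedy, max_eq_left hle]
  · rw [greedy, max_eq_left hle]

theorem runs_scan (hn : 0 < n) (hcol : ∀ i < n, color i < k) {s : State}
    (h1 : s.nat Reg.size = n) (h2 : s.nat Reg.colors = k) (h3 : s.realArr Arr.x = x)
    (h4 : s.natArr Arr.color = color) :
    Runs (.seq scanInit (.loop (.natLt Reg.j Reg.size) scanBody)) s
      ((scanInit.blockCost + 6 * (1 + scanBody.blockCost)) * n) fun s' =>
        ∃ nxt hp, IsLinkTable n k color nxt hp ∧ LinkState n k x color nxt hp s' := by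
  refine Runs.block_loop hn (ScanState n k x color)
    (fun s => 3 * (n - s.nat Reg.j) + (n - s.nat Reg.l) + (1 - s.nat Reg.mode)) ?_
    (wp_scanBody hcol) fun s' hs hj => ?_
  · simp [scanInit, ScanState, Env, h1, h2, h3, h4, ScanInv.start]
    omega
  · obtain ⟨he, hjn, h⟩ := hs
    simp only [Test.Holds, he.1] at hj
    rcases h with ⟨-, h⟩ | ⟨-, hlt, -⟩
    · rw [show s'.nat Reg.j = n by omega] at h
      exact ⟨_, _, h.isLinkTable, he, rfl, rfl⟩
    · exact absurd hlt hj

theorem runs_list {nxt hp : ℕ → ℕ} (hn : 0 < n) (ht : IsLinkTable n k color nxt hp) {s : State}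
    (h : LinkState n k x color nxt hp s) :
    Runs (.seq listInit (.loop (.natLt Reg.p Reg.size) listBody)) s
      ((listInit.blockCost + 3 * (1 + listBody.blockCost)) * n) fun s' =>
        ∃ m q Y, m ≤ n ∧ IsPathList n x nxt (x (n - 1) - x 0 + 2) m q Y ∧
          PathState n k x color m q Y s' ∧ s'.real Reg.B = x (n - 1) - x 0 + 2 := by
  refine Runs.block_loop hn (ListState n k x color nxt hp (x (n - 1) - x 0 + 2))
    (fun s => (n - s.nat Reg.p) + (n - s.nat Reg.m)) ?_ (wp_listBody ht) fun s' hs hp0 => ?_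
  · obtain ⟨⟨h1, h2, h3, h4, h5, h6⟩, h7, h8⟩ := h
    simp [listInit, ListState, LinkState, Env, h1, h2, h3, h4, h5, h6, h7, h8, ListInv.init]
    omega
  · obtain ⟨he, hB, h⟩ := hs
    simp only [Test.Holds, he.1.1] at hp0
    have hle := h.length_le
    rw [show s'.nat Reg.p = n by have := h.le; omega] at h
    exact ⟨_, _, _, hle, h.isPathList ht, ⟨he.1, rfl, rfl, rfl⟩, hB⟩

theorem runs_hull {m : ℕ} {q : ℕ → ℕ} {Y : ℕ → ℝ} {B : ℝ} (hm : 0 < m) (hmn : m ≤ n) {s : State}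
    (h : PathState n k x color m q Y s) (hB : s.real Reg.B = B) :
    Runs (.seq hullInit (.loop (.natLt Reg.t Reg.m) hullBody)) s
      ((hullInit.blockCost + 3 * (1 + hullBody.blockCost)) * n) fun s' =>
        ∃ L, IsMinSlope m Y B L ∧ PathState n k x color m q Y s' ∧ s'.real Reg.L = L := by
  refine Runs.block_loop (hm.trans_le hmn) (HullState n k x color m q Y B)
    (fun s => 3 * (m - s.nat Reg.t) + (s.nat Reg.e - s.nat Reg.f) + (1 - s.nat Reg.mode)) ?_
    wp_hullBody fun s' hs ht => ?_
  · obtain ⟨⟨h1, h2, h3, h4, h5, h6⟩, h7, h8, h9⟩ := h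
    simp [hullInit, HullState, PathState, Env, h1, h2, h3, h4, h5, h6, h7, h8, h9, hB]
    exact ⟨⟨hm, FrontInv.start (by simp)⟩, by omega⟩
  · obtain ⟨he, htm, h⟩ := hs
    simp only [Test.Holds, he.2.1] at ht
    rcases h with ⟨-, h⟩ | ⟨-, hlt, -⟩
    · rw [show s'.nat Reg.t = m by omega] at h
      exact ⟨_, h.isMinSlope, he, rfl⟩
    · exact absurd hlt ht

theorem runs_place {m : ℕ} {q : ℕ → ℕ} {Y : ℕ → ℝ} {L : ℝ} (hn : 0 < n) (hmn : m ≤ n)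
    (hq : ∀ t < m, ∀ t' < m, q t = q t' → t = t') {s : State}
    (h : PathState n k x color m q Y s) (hL : s.real Reg.L = L) :
    Runs (.seq placeInit (.loop (.natLt Reg.t Reg.m) placeBody)) s
      ((placeInit.blockCost + 2 * (1 + placeBody.blockCost)) * n) fun s' =>
        ∀ t < m, s'.realArr Arr.out (q t) = x (q t) + greedy Y L (t + 1) - Y t := by
  refine Runs.block_loop hn (PlaceState n k x color m q Y L)
    (fun s => m - s.nat Reg.t) ?_ (wp_placeBody hq) fun s' hs ht => ?_
  · obtain ⟨⟨h1, h2, h3, h4, h5, h6⟩, h7, h8, h9⟩ := h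
    simp [placeInit, PlaceState, PathState, Env, h1, h2, h3, h4, h5, h6, h7, h8, h9, hL, greedy]
    omega
  · obtain ⟨he, -, -, htm, h⟩ := hs
    simp only [Test.Holds, he.2.1] at ht
    rwa [show s'.nat Reg.t = m by omega] at h

end

end LMCSI

theorem theorem2p2 :
    ∃ (P : RealRAM.Program) (C : ℕ),
      ∀ (n k : ℕ) (x : Fin n → ℝ) (color : Fin n → Fin k),
        0 < n →
        Monotone x →
        Pairwise (fun i j : Fin n => Disjoint (LMCSI.unitSegment x i) (LMCSI.unitSegment x j)) →
        Function.Surjective color →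
        ∀ s : RealRAM.State, LMCSI.HoldsInput x color s →
          ∃ (t : ℕ) (s' : RealRAM.State),
            RealRAM.Exec P s t s' ∧ t ≤ C * n ∧
              LMCSI.IsSolution x color (LMCSI.output n s') := by
  open LMCSI in
  refine ⟨solver, (scanInit.blockCost + 6 * (1 + scanBody.blockCost)) +
    ((listInit.blockCost + 3 * (1 + listBody.blockCost)) +
      ((hullInit.blockCost + 3 * (1 + hullBody.blockCost)) +
        (placeInit.blockCost + 2 * (1 + placeBody.blockCost)))),
    fun n k x color hn hx hd hc s ⟨h1, h2, h3⟩ => ?_⟩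
  have hcol : ∀ i < n, s.natArr Arr.color i < k := fun i hi =>
    (h3 ⟨i, hi⟩).2.symm ▸ (color ⟨i, hi⟩).2
  have hrun : RealRAM.Runs solver s _ fun s' => IsSolution x color (output n s') :=
    (runs_scan hn hcol h1 h2 rfl rfl).seq fun s₁ ⟨nxt, hp, ht, hs₁⟩ =>
      (runs_list hn ht hs₁).seq fun s₂ ⟨m, q, Y, hmn, hl, hs₂, hB⟩ =>
        (runs_hull (Nat.zero_lt_of_lt (hl.surj 0 hn).choose_spec.1) hmn hs₂ hB).seq
          fun s₃ ⟨L, hL, hs₃, hsL⟩ =>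
            (runs_place hn hmn hl.inj hs₃ hsL).mono le_rfl fun s' hout =>
              isSolution_of_greedy hn hx hd hc (fun i => (h3 i).1) (fun i => (h3 i).2) ht rfl hl hL
                hout
  exact hrun.mono (le_of_eq (by ring)) fun _ => id
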